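/- \textbf{Conventions.} Let $A$ be a finite alphabet, $A^*$ the free monoid on $A$ and $\varepsilon$ the empty word. A set $S$ of words on an alphabet $A$ is \emph{factorial} if it contains $A$ and all factors of its elements; it is \emph{biextendable} if it is factorial and for each $w\in S$ there are letters $a,b\in A$ with $awb\in S$; it is \emph{recurrent} if $S\neq\{\varepsilon\}$, $S$ is factorial, and for all $u,w\in S$ there is $v\in S$ with $uvw\in S$. For $w\in S$, the \emph{extension graph} $\mathcal E_S(w)$ is the undirected graph whose vertex set is the disjoint union of $L_S(w)=\{a\in A: aw\in S\}$ and $R_S(w)=\{b\in A: wb\in S\}$, with an edge between the left vertex $a$ and the right vertex $b$ whenever $awb\in S$. A biextendable set $S$ is a \emph{tree set of characteristic $c$} if $\mathcal E_S(w)$ is a tree for every nonempty $w\in S$ and $\mathcal E_S(\varepsilon)$ is a disjoint union of $c$ trees. Let $\theta$ be an involution of $A$, possibly with fixed points. A word is \emph{reduced} if it has no factor $a\,\theta(a)$ with $a\in A$. A \emph{specular set} on $A$ relative to $\theta$ is a tree set $S$ of characteristic $2$ on $A$ consisting of reduced words and closed under the inversion $a_1\cdots a_n\mapsto \theta(a_n)\cdots\theta(a_1)$.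 For such an $S$, let $\mathcal T_0,\mathcal T_1$ be the two trees of $\mathcal E_S(\varepsilon)$, numbered in an arbitrary way. A letter is \emph{even} if its left and right occurrences in $\mathcal E_S(\varepsilon)$ lie in the same tree, and \emph{odd} otherwise. A word of $S$ is \emph{even} if it has an even number of odd letters. The \emph{even code} $X$ of $S$ is the set of nonempty even words having no proper nonempty even prefix. The \emph{parity graph} of $S$ is the directed graph with vertices $0,1$ and an edge $i\xrightarrow{a}j$ whenever, for some $b,c\in A$, the edge from left vertex $b$ to right vertex $a$ lies in $\mathcal T_i$ and the edge from left vertex $a$ to right vertex $c$ lies in $\mathcal T_j$. Let $S_{i,j}$ be the set of words of $S$ that label a path from $i$ to $j$ in the parity graph (in particular $\varepsilon\in S_{0,0}\cap S_{1,1}$). A \emph{coding morphism} for $X$ is a monoid morphism $f:B^*\to A^*$, where $B$ is a set of letters, that maps the set $B$ bijectively onto $X$. \textbf{Theorem (Even code decoding Theorem).} Let $S$ be a recurrent specular set on a finite alphabet $A$, let $X$ be its even code and let $f:B^*\to A^*$ be a coding morphism for $X$. Then $B$ is finite, \[ f^{-1}(S)=f^{-1}(S_{0,0})\cup f^{-1}(S_{1,1}),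 \] and, for $i=0,1$, the set $f^{-1}(S_{i,i})$ is a recurrent tree set of characteristic $1$ on the alphabet $B_i=\{b\in B: f(b)\in X\cap S_{i,i}\}$. In particular, the decoding $f^{-1}(S)$ of $S$ by its even code is a union of two recurrent tree sets of characteristic $1$. -/

import Mathlib

namespace WordSet

variable {A : Type*}

/-- `L_S(w)`: the letters `a` with `aw ∈ S`. -/
def leftExt (S : Set (List A)) (w : List A) : Set A := {a | a :: w ∈ S}

/-- `R_S(w)`: the letters `b` with `wb ∈ S`. -/
def rightExt (S : Set (List A)) (w : List A) : Set A := {b | w ++ [b] ∈ S}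

/-- The extension graph of `w` in `S`: its vertex set is the disjoint union of `L_S(w)` and
`R_S(w)`, and its edges join the left copy of `a` to the right copy of `b` whenever `awb ∈ S`. -/
def extGraph (S : Set (List A)) (w : List A) :
    SimpleGraph (leftExt S w ⊕ rightExt S w) where
  Adj x y :=
    match x, y with
    | Sum.inl a, Sum.inr b => a.1 :: (w ++ [b.1]) ∈ S
    | Sum.inr b, Sum.inl a => a.1 :: (w ++ [b.1]) ∈ S
    | _, _ => False
  symm := ⟨by
    rintro (a | a) (b | b) h
    · exact h
    · exact h
    · exact h
    · exact h⟩
  loopless := ⟨by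
    rintro (a | a) h
    · exact h
    · exact h⟩

/-- `S` is a factorial set of words on the alphabet `A₀` (a set of letters): the letters of the
words of `S` lie in `A₀`, and `S` contains `A₀` and all the factors of its elements. -/
structure IsFactorial (A₀ : Set A) (S : Set (List A)) : Prop where
  letters : ∀ w ∈ S, ∀ a ∈ w, a ∈ A₀
  alphabet : ∀ a ∈ A₀, [a] ∈ S
  factor : ∀ w ∈ S, ∀ v : List A, v <:+: w → v ∈ S

/-- `S` is a biextendable set on the alphabet `A₀`: it is factorial and for every `w ∈ S` there
are letters `a, b` such that `awb ∈ S`. -/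
structure IsBiextendable (A₀ : Set A) (S : Set (List A)) : Prop extends IsFactorial A₀ S where
  extend : ∀ w ∈ S, ∃ a b : A, a :: (w ++ [b]) ∈ S

/-- `S` is a recurrent set on the alphabet `A₀`. -/
structure IsRecurrent (A₀ : Set A) (S : Set (List A)) : Prop extends IsFactorial A₀ S where
  ne_empty_word : S ≠ {[]}
  recurrent : ∀ u ∈ S, ∀ w ∈ S, ∃ v ∈ S, u ++ v ++ w ∈ S

/-- `S` is a tree set of characteristic `c` on the alphabet `A₀`: the extension graph of every
nonempty word of `S` is a tree, and that of the empty word is a disjoint union of `c` trees, that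
is, an acyclic graph with exactly `c` connected components. -/
structure IsTreeSet (A₀ : Set A) (c : ℕ) (S : Set (List A)) : Prop
    extends IsBiextendable A₀ S where
  tree : ∀ w ∈ S, w ≠ [] → (extGraph S w).IsTree
  acyclic_empty : (extGraph S []).IsAcyclic
  finite_components : Finite (extGraph S []).ConnectedComponent
  card_components : Nat.card (extGraph S []).ConnectedComponent = c

/-- The inverse of a word in the specular group defined by the involution `θ` on the letters. -/
def inv (θ : A → A) (w : List A) : List A := (w.map θ).reverse

/-- A word is `θ`-reduced if it has no factor `a θ(a)`. -/
def IsReduced (θ : A → A) (w : List A) : Prop := ∀ a : A, ¬ [a, θ a] <:+: w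

/-- `S` is a laminary set on the whole alphabet `A`, relative to `θ`. -/
structure IsLaminary (θ : A → A) (S : Set (List A)) : Prop
    extends IsBiextendable Set.univ S where
  symmetric : ∀ w ∈ S, inv θ w ∈ S
  reduced : ∀ w ∈ S, IsReduced θ w

/-- A specular set is a laminary set which is a tree set of characteristic `2`. -/
structure IsSpecular (θ : A → A) (S : Set (List A)) : Prop where
  laminary : IsLaminary θ S
  treeSet : IsTreeSet Set.univ 2 S

/-- A letter is even if its two occurrences, as a left vertex and as a right vertex of the
extension graph of the empty word, are in the same connected component. -/
def IsEvenLetter (S : Set (List A)) (a : A) : Prop :=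
  ∃ (hl : a ∈ leftExt S []) (hr : a ∈ rightExt S []),
    (extGraph S []).Reachable (Sum.inl ⟨a, hl⟩) (Sum.inr ⟨a, hr⟩)

open Classical in
/-- A word of `S` is even if it has an even number of odd (that is, not even) letters. -/
def IsEvenWord (S : Set (List A)) (w : List A) : Prop :=
  w ∈ S ∧ Even (w.countP (fun a => decide (¬ IsEvenLetter S a)))

/-- The even code of `S`: the nonempty even words without a proper nonempty even prefix. -/
def evenCode (S : Set (List A)) : Set (List A) :=
  {x | IsEvenWord S x ∧ x ≠ [] ∧ ∀ p : List A, p <+: x → p ≠ [] → p ≠ x → ¬ IsEvenWord S p}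

/-- `(1 ⊗ a, b ⊗ 1)` is an edge of the connected component `T` of the extension graph of the
empty word. -/
def EdgeIn (S : Set (List A)) (T : (extGraph S []).ConnectedComponent) (a b : A) : Prop :=
  ∃ (ha : a ∈ leftExt S []) (hb : b ∈ rightExt S []),
    (extGraph S []).Adj (Sum.inl ⟨a, ha⟩) (Sum.inr ⟨b, hb⟩) ∧
      (extGraph S []).connectedComponentMk (Sum.inl ⟨a, ha⟩) = T

/-- The edges `(i, a, j)` of the parity graph of `S`, the two trees of the extension graph of the
empty word being numbered `T 0` and `T 1`. -/
def ParityEdge (S : Set (List A)) (T : Fin 2 → (extGraph S []).ConnectedComponent)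
    (i : Fin 2) (a : A) (j : Fin 2) : Prop :=
  ∃ b c : A, EdgeIn S (T i) b a ∧ EdgeIn S (T j) a c

/-- The word is the label of a path from `i` to `j` in the parity graph. -/
def ParityPath (S : Set (List A)) (T : Fin 2 → (extGraph S []).ConnectedComponent) :
    Fin 2 → List A → Fin 2 → Prop
  | i, [], j => i = j
  | i, a :: w, j => ∃ k : Fin 2, ParityEdge S T i a k ∧ ParityPath S T k w j

/-- `S_{i,j}`: the words of `S` that are the label of a path from `i` to `j` in the parity
graph. -/
def parityClass (S : Set (List A)) (T : Fin 2 → (extGraph S []).ConnectedComponent)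
    (i j : Fin 2) : Set (List A) :=
  {w | w ∈ S ∧ ParityPath S T i w j}

variable {B : Type*}

/-- The morphism `f : B* → A*` is a coding morphism for `X`: it maps `B` bijectively onto `X`. -/
def IsCodingMorphism (f : FreeMonoid B →* FreeMonoid A) (X : Set (List A)) : Prop :=
  Set.BijOn (fun b : B => (f (FreeMonoid.of b)).toList) Set.univ X

/-- The inverse image `f⁻¹(U)` of a set `U` of words under the morphism `f : B* → A*`. -/
def decode (f : FreeMonoid B →* FreeMonoid A) (U : Set (List A)) : Set (List B) :=
  {w | (f (FreeMonoid.ofList w)).toList ∈ U}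

/-- The letters of `B` whose image under `f : B* → A*` lies in the set `U` of words. -/
def decodeLetters (f : FreeMonoid B →* FreeMonoid A) (U : Set (List A)) : Set B :=
  {b | (f (FreeMonoid.of b)).toList ∈ U}

end WordSet

/-! Number the two trees of the extension graph of `ε`. A letter `a` then carries two states, the
tree `l a` of its left occurrence and the tree `r a` of its right occurrence, and `l a = r b`
whenever `ab ∈ S`. Hence the parity graph has a single edge `r a → l a` for each letter `a`, and
every nonempty word of `S` labels exactly one path. Odd letters switch the state and even letters
keep it, so the even words of `S` are those that label loops. A word of the even code is an even
letter, or runs from one odd letter to the next. A nonempty product of code words lying in `S` is a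
loop around one of the two states, which gives the decomposition of `f⁻¹(S)`.

Two points carry the rest. The first is that runs of even letters in `S` are bounded
(`exists_length_le`), so the code is finite. By the tree condition, the right excess (number of
right extensions minus one) of a nonempty word is the sum of those of its left extensions. Summed
over longer and longer even runs on the left, the excess cannot increase, so it stabilizes; from
then on, words made of an odd letter and a long even run have a unique right extension. As
recurrence forces an odd letter to occur later, such a run must stop after a bounded number of
letters.

The second is that extension graphs remain trees when letters are replaced by code words. Replacing
a vertex of a tree by a tree on its neighbours and new vertices yields a tree (`BipTree.subst`), so
right extensions can be lengthened letter by letter; boundedness makes the process stop. Reversal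
gives the left side. For `ε` one starts from a single component, which produces one tree for each
state (`wTree_leftCode_rightCode`). The coding morphism identifies these graphs with the extension
graphs of the decoded set (`bipTree_decodeLoops`). -/

namespace WordSet

/-! ### Finite bipartite trees -/

/-- A finite bipartite graph, with vertex classes `L` and `R` and adjacency relation `E`, that is a
tree: it is connected (a property of vertices that is constant along the edges is constant)
and it has one vertex more than it has edges. -/
structure BipTree {α β : Type*} (L : Set α) (R : Set β) (E : α → β → Prop) : Prop where
  finite_left : L.Finite
  finite_right : R.Finite
  card : L.ncard + R.ncard = {e : α × β | e.1 ∈ L ∧ e.2 ∈ R ∧ E e.1 e.2}.ncard + 1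
  conn : ∀ (p : α → Prop) (q : β → Prop), (∀ l ∈ L, ∀ r ∈ R, E l r → (p l ↔ q r)) →
    ((∃ l ∈ L, p l) ∨ ∃ r ∈ R, q r) → (∀ l ∈ L, p l) ∧ ∀ r ∈ R, q r

theorem ncard_eq_sum_fiber {α β : Type*} {s : Set α} {t : Set β} (hs : s.Finite) (ht : t.Finite)
    (f : α → β) (h : ∀ a ∈ s, f a ∈ t) :
    s.ncard = ∑ b ∈ ht.toFinset, {a | a ∈ s ∧ f a = b}.ncard := by
  classical
  rw [Set.ncard_eq_toFinset_card s hs,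
    Finset.card_eq_sum_card_fiberwise (f := f) (t := ht.toFinset) (by intro a ha; simpa using h a (by simpa using ha))]
  refine Finset.sum_congr rfl fun b _ => ?_
  rw [← Set.ncard_coe_finset]
  congr 1
  ext a
  simp

namespace BipTree

variable {α β γ δ : Type*} {L : Set α} {R : Set β} {E : α → β → Prop}

theorem swap (h : BipTree L R E) : BipTree R L (fun r l => E l r) where
  finite_left := h.finite_right
  finite_right := h.finite_left
  card := by
    rw [add_comm, h.card, ← Set.ncard_image_of_injective _ Prod.swap_injective]
    congr 2
    ext ⟨r, l⟩
    simp only [Set.image_swap_eq_preimage_swap, Set.mem_preimage, Set.mem_ofPred_eq, Prod.swap_prod_mk]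
    tauto
  conn p q hpq hex :=
    (h.conn q p (fun l hl r hr hlr => (hpq r hr l hl hlr).symm) hex.symm).symm

/-- Transport along relabellings of the vertices. It serves to reverse words, to identify letters
with one-letter words, and to pass from letters of `B` to code words. -/
theorem image_iff {f : α → γ} {g : β → δ} {E' : γ → δ → Prop} (hf : Set.InjOn f L)
    (hg : Set.InjOn g R) (hE : ∀ l ∈ L, ∀ r ∈ R, (E l r ↔ E' (f l) (g r))) :
    BipTree (f '' L) (g '' R) E' ↔ BipTree L R E := by
  have hcard : {e : γ × δ | e.1 ∈ f '' L ∧ e.2 ∈ g '' R ∧ E' e.1 e.2}.ncard =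
      {e : α × β | e.1 ∈ L ∧ e.2 ∈ R ∧ E e.1 e.2}.ncard := by
    have hinj : Set.InjOn (Prod.map f g) {e : α × β | e.1 ∈ L ∧ e.2 ∈ R ∧ E e.1 e.2} := by
      rintro ⟨a, b⟩ ⟨ha, hb, _⟩ ⟨c, d⟩ ⟨hc, hd, _⟩ h
      simp only [Prod.map_apply, Prod.mk.injEq] at h
      exact Prod.ext (hf ha hc h.1) (hg hb hd h.2)
    rw [← hinj.ncard_image]
    congr 1
    ext ⟨c, d⟩
    constructor
    · rintro ⟨⟨l, hl, rfl⟩, ⟨r, hr, rfl⟩, h⟩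
      exact ⟨(l, r), ⟨hl, hr, (hE l hl r hr).2 h⟩, rfl⟩
    · rintro ⟨⟨l, r⟩, ⟨hl, hr, h⟩, h'⟩
      simp only [Prod.map_apply, Prod.mk.injEq] at h'
      obtain ⟨rfl, rfl⟩ := h'
      exact ⟨⟨l, hl, rfl⟩, ⟨r, hr, rfl⟩, (hE l hl r hr).1 h⟩
  constructor
  · intro h
    refine ⟨h.finite_left.of_finite_image hf, h.finite_right.of_finite_image hg, ?_, ?_⟩
    · rw [← hcard, ← h.card, hf.ncard_image, hg.ncard_image]
    · intro p q hpq hex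
      have key := h.conn (fun c => ∃ l ∈ L, f l = c ∧ p l) (fun d => ∃ r ∈ R, g r = d ∧ q r) (by
        rintro _ ⟨l, hl, rfl⟩ _ ⟨r, hr, rfl⟩ hlr
        have h1 := hpq l hl r hr ((hE l hl r hr).2 hlr)
        constructor
        · rintro ⟨l', hl', h', hp⟩
          rw [hf hl' hl h'] at hp
          exact ⟨r, hr, rfl, h1.1 hp⟩
        · rintro ⟨r', hr', h', hp⟩
          rw [hg hr' hr h'] at hp
          exact ⟨l, hl, rfl, h1.2 hp⟩) (by
        rcases hex with ⟨l, hl, hp⟩ | ⟨r, hr, hq⟩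
        · exact Or.inl ⟨f l, ⟨l, hl, rfl⟩, l, hl, rfl, hp⟩
        · exact Or.inr ⟨g r, ⟨r, hr, rfl⟩, r, hr, rfl, hq⟩)
      constructor
      · intro l hl
        obtain ⟨l', hl', h', hp⟩ := key.1 _ ⟨l, hl, rfl⟩
        rwa [hf hl' hl h'] at hp
      · intro r hr
        obtain ⟨r', hr', h', hp⟩ := key.2 _ ⟨r, hr, rfl⟩
        rwa [hg hr' hr h'] at hp
  · intro h
    refine ⟨h.finite_left.image f, h.finite_right.image g, ?_, ?_⟩
    · rw [hcard, ← h.card, hf.ncard_image, hg.ncard_image]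
    · intro p q hpq hex
      have key := h.conn (p ∘ f) (q ∘ g) (fun l hl r hr hlr =>
        hpq _ ⟨l, hl, rfl⟩ _ ⟨r, hr, rfl⟩ ((hE l hl r hr).1 hlr)) (by
          rcases hex with ⟨_, ⟨l, hl, rfl⟩, hp⟩ | ⟨_, ⟨r, hr, rfl⟩, hq⟩
          · exact Or.inl ⟨l, hl, hp⟩
          · exact Or.inr ⟨r, hr, hq⟩)
      exact ⟨Set.forall_mem_image.2 key.1, Set.forall_mem_image.2 key.2⟩

/-- A star is a tree. -/
theorem star (hL : L.Finite) (b : β) (hE : ∀ l ∈ L, E l b) : BipTree L {b} E where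
  finite_left := hL
  finite_right := Set.finite_singleton b
  card := by
    have : {e : α × β | e.1 ∈ L ∧ e.2 ∈ ({b} : Set β) ∧ E e.1 e.2} = (fun l => (l, b)) '' L := by
      ext ⟨l, r⟩
      simp only [Set.mem_singleton_iff, Set.mem_ofPred_eq, Set.mem_image, Prod.mk.injEq]
      constructor
      · rintro ⟨hl, rfl, _⟩
        exact ⟨l, hl, rfl, rfl⟩
      · rintro ⟨l, hl, rfl, rfl⟩
        exact ⟨hl, rfl, hE l hl⟩
    rw [this, Set.ncard_image_of_injective _ (fun _ _ h => (Prod.mk.inj h).1), Set.ncard_singleton]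
  conn p q hpq hex := by
    have hq : q b := by
      rcases hex with ⟨l, hl, hp⟩ | ⟨r, rfl, hq⟩
      · exact (hpq l hl b rfl (hE l hl)).1 hp
      · exact hq
    exact ⟨fun l hl => (hpq l hl b rfl (hE l hl)).2 hq, fun r hr => by rwa [Set.mem_singleton_iff.1 hr]⟩

/-- Replacing each right vertex of a tree by a tree on its neighbours and new right vertices
yields a tree. -/
theorem subst {R' : Set γ} {E' : α → γ → Prop} (h : BipTree L R E) (π : γ → β)
    (hπ : ∀ c ∈ R', π c ∈ R)
    (hfib : ∀ r ∈ R, BipTree {l | l ∈ L ∧ E l r} {c | c ∈ R' ∧ π c = r} E')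
    (hE : ∀ l ∈ L, ∀ c ∈ R', E' l c → E l (π c)) : BipTree L R' E' := by
  have hR' : R'.Finite := by
    refine (h.finite_right.biUnion fun r hr => (hfib r hr).finite_right).subset fun c hc => ?_
    exact Set.mem_biUnion (hπ c hc) ⟨hc, rfl⟩
  refine ⟨h.finite_left, hR', ?_, ?_⟩
  · have e1 := ncard_eq_sum_fiber hR' h.finite_right π hπ
    have e2 := ncard_eq_sum_fiber (s := {e : α × β | e.1 ∈ L ∧ e.2 ∈ R ∧ E e.1 e.2})
      ((h.finite_left.prod h.finite_right).subset fun e he => ⟨he.1, he.2.1⟩) h.finite_right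
      Prod.snd (fun e he => he.2.1)
    have e3 := ncard_eq_sum_fiber (s := {e : α × γ | e.1 ∈ L ∧ e.2 ∈ R' ∧ E' e.1 e.2})
      ((h.finite_left.prod hR').subset fun e he => ⟨he.1, he.2.1⟩) h.finite_right
      (fun e => π e.2) (fun e he => hπ _ he.2.1)
    have e4 : R.ncard = ∑ b ∈ h.finite_right.toFinset, 1 := by
      rw [Set.ncard_eq_toFinset_card R h.finite_right]; simp
    -- Sum over `r ∈ R` of the vertex counts of the trees over `r`: the degree of `r` plus the size
    -- of its fibre is the number of edges over `r` plus one.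
    have e5 : {e : α × γ | e.1 ∈ L ∧ e.2 ∈ R' ∧ E' e.1 e.2}.ncard + R.ncard =
        {e : α × β | e.1 ∈ L ∧ e.2 ∈ R ∧ E e.1 e.2}.ncard + R'.ncard := by
      rw [e1, e2, e3, e4, ← Finset.sum_add_distrib, ← Finset.sum_add_distrib]
      refine Finset.sum_congr rfl fun r hr => ?_
      rw [Set.Finite.mem_toFinset] at hr
      have h2 : {e : α × β | e ∈ {e : α × β | e.1 ∈ L ∧ e.2 ∈ R ∧ E e.1 e.2} ∧ e.2 = r}
          = (fun l => (l, r)) '' {l | l ∈ L ∧ E l r} := by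
        ext ⟨l, r'⟩
        simp only [Set.mem_ofPred_eq, Set.mem_image, Prod.mk.injEq]
        constructor
        · rintro ⟨⟨h1, h2, h3⟩, rfl⟩
          exact ⟨l, ⟨h1, h3⟩, rfl, rfl⟩
        · rintro ⟨l', ⟨h1, h3⟩, rfl, rfl⟩
          exact ⟨⟨h1, hr, h3⟩, rfl⟩
      have h3 : {e : α × γ | e ∈ {e : α × γ | e.1 ∈ L ∧ e.2 ∈ R' ∧ E' e.1 e.2} ∧ π e.2 = r}
          = {e : α × γ | e.1 ∈ {l | l ∈ L ∧ E l r} ∧ e.2 ∈ {c | c ∈ R' ∧ π c = r} ∧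
              E' e.1 e.2} := by
        ext ⟨l, c⟩
        simp only [Set.mem_ofPred_eq]
        constructor
        · rintro ⟨⟨hl, hc, hlc⟩, rfl⟩
          exact ⟨⟨hl, hE _ hl _ hc hlc⟩, ⟨hc, rfl⟩, hlc⟩
        · rintro ⟨⟨hl, _⟩, ⟨hc, hcr⟩, hlc⟩
          exact ⟨⟨hl, hc, hlc⟩, hcr⟩
      rw [h2, h3, Set.ncard_image_of_injective _ (fun _ _ h => (Prod.mk.inj h).1),
        ← (hfib r hr).card]
    have e6 := h.card
    omega
  · intro p q hpq hex
    have hfibc : ∀ r ∈ R, ((∃ l ∈ L, E l r ∧ p l) ∨ ∃ c ∈ R', π c = r ∧ q c) →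
        (∀ l ∈ L, E l r → p l) ∧ ∀ c ∈ R', π c = r → q c := by
      intro r hr hr'
      have := (hfib r hr).conn p q (fun l hl c hc hlc => hpq l hl.1 c hc.1 hlc) (by
        rcases hr' with ⟨l, hl, hlr, hp⟩ | ⟨c, hc, hcr, hq⟩
        · exact Or.inl ⟨l, ⟨hl, hlr⟩, hp⟩
        · exact Or.inr ⟨c, ⟨hc, hcr⟩, hq⟩)
      exact ⟨fun l hl hlr => this.1 l ⟨hl, hlr⟩, fun c hc hcr => this.2 c ⟨hc, hcr⟩⟩
    -- Connectedness of the tree over `r` makes the property "some neighbour or fibre element of `r`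
    -- is marked" equivalent to "all are marked", so it propagates along the original tree.
    have key := h.conn p (fun r => (∃ l ∈ L, E l r ∧ p l) ∨ ∃ c ∈ R', π c = r ∧ q c)
      (fun l hl r hr hlr => ⟨fun hp => Or.inl ⟨l, hl, hlr, hp⟩,
        fun hr' => (hfibc r hr hr').1 l hl hlr⟩) (by
        rcases hex with ⟨l, hl, hp⟩ | ⟨c, hc, hq⟩
        · exact Or.inl ⟨l, hl, hp⟩
        · exact Or.inr ⟨π c, hπ c hc, Or.inr ⟨c, hc, rfl, hq⟩⟩)
    exact ⟨key.1, fun c hc => (hfibc _ (hπ c hc) (key.2 _ (hπ c hc))).2 c hc rfl⟩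

end BipTree

/-! ### Comparison with trees as simple graphs -/

section Graph

variable {α β : Type*} {L : Set α} {R : Set β} {E : α → β → Prop}

/-- The bipartite graph with vertex classes `L` and `R` and adjacency relation `E`. -/
def bipGraph (L : Set α) (R : Set β) (E : α → β → Prop) : SimpleGraph (L ⊕ R) where
  Adj x y :=
    match x, y with
    | Sum.inl a, Sum.inr b => E a.1 b.1
    | Sum.inr b, Sum.inl a => E a.1 b.1
    | _, _ => False
  symm := ⟨by rintro (a | a) (b | b) h <;> exact h⟩
  loopless := ⟨by rintro (a | a) h <;> exact h⟩

theorem card_edgeSet_bipGraph (L : Set α) (R : Set β) (E : α → β → Prop) :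
    Nat.card (bipGraph L R E).edgeSet = {e : α × β | e.1 ∈ L ∧ e.2 ∈ R ∧ E e.1 e.2}.ncard := by
  rw [← Nat.card_coe_set_eq]
  symm
  refine Nat.card_congr (Equiv.ofBijective (fun e =>
    ⟨s(Sum.inl ⟨e.1.1, e.2.1⟩, Sum.inr ⟨e.1.2, e.2.2.1⟩), e.2.2.2⟩) ⟨?_, ?_⟩)
  · rintro ⟨⟨a, b⟩, ha, hb, hab⟩ ⟨⟨c, d⟩, hc, hd, hcd⟩ h
    have h' := congrArg Subtype.val h
    simp at h'
    exact Subtype.ext (Prod.ext h'.1 h'.2)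
  · rintro ⟨e, he⟩
    induction e using Sym2.ind with
    | _ x y =>
      rcases x with x | x <;> rcases y with y | y
      · exact he.elim
      · exact ⟨⟨(x.1, y.1), x.2, y.2, he⟩, rfl⟩
      · exact ⟨⟨(y.1, x.1), y.2, x.2, he⟩, Subtype.ext Sym2.eq_swap⟩
      · exact he.elim

theorem isTree_bipGraph_iff (hL : L.Finite) (hR : R.Finite) :
    (bipGraph L R E).IsTree ↔ BipTree L R E := by
  have := hL.to_subtype
  have := hR.to_subtype
  rw [SimpleGraph.isTree_iff_connected_and_card, card_edgeSet_bipGraph, Nat.card_sum,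
    Nat.card_coe_set_eq, Nat.card_coe_set_eq]
  constructor
  · rintro ⟨hc, hcard⟩
    refine ⟨hL, hR, hcard.symm, ?_⟩
    intro p q hpq hex
    have step : ∀ x y : L ⊕ R, (bipGraph L R E).Adj x y →
        Sum.elim (fun l => p l.1) (fun r => q r.1) x →
        Sum.elim (fun l : L => p l.1) (fun r : R => q r.1) y := by
      rintro (x | x) (y | y) hxy hx
      · exact hxy.elim
      · exact (hpq _ x.2 _ y.2 hxy).1 hx
      · exact (hpq _ y.2 _ x.2 hxy).2 hx
      · exact hxy.elim
    have walk : ∀ x y : L ⊕ R, (bipGraph L R E).Walk x y →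
        Sum.elim (fun l => p l.1) (fun r => q r.1) x →
        Sum.elim (fun l : L => p l.1) (fun r : R => q r.1) y := by
      intro x y w
      induction w with
      | nil => exact id
      | cons hxy _ ih => exact fun hx => ih (step _ _ hxy hx)
    obtain ⟨x, hx⟩ : ∃ x : L ⊕ R, Sum.elim (fun l : L => p l.1) (fun r : R => q r.1) x := by
      rcases hex with ⟨l, hl, hp⟩ | ⟨r, hr, hq⟩
      · exact ⟨Sum.inl ⟨l, hl⟩, hp⟩
      · exact ⟨Sum.inr ⟨r, hr⟩, hq⟩
    have all : ∀ y : L ⊕ R, Sum.elim (fun l : L => p l.1) (fun r : R => q r.1) y := fun y => by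
      obtain ⟨w⟩ := hc.preconnected x y
      exact walk x y w hx
    exact ⟨fun l hl => all (Sum.inl ⟨l, hl⟩), fun r hr => all (Sum.inr ⟨r, hr⟩)⟩
  · intro h
    refine ⟨?_, h.card.symm⟩
    have hpre : (bipGraph L R E).Preconnected := by
      intro x y
      -- The property propagated along the edges is reachability from the fixed vertex `x`.
      have key := h.conn
        (fun l => ∃ hl : l ∈ L, (bipGraph L R E).Reachable x (Sum.inl ⟨l, hl⟩))
        (fun r => ∃ hr : r ∈ R, (bipGraph L R E).Reachable x (Sum.inr ⟨r, hr⟩)) (by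
          intro l hl r hr hlr
          have hadj : (bipGraph L R E).Adj (Sum.inl ⟨l, hl⟩) (Sum.inr ⟨r, hr⟩) := hlr
          exact ⟨fun ⟨_, h⟩ => ⟨hr, h.trans hadj.reachable⟩,
            fun ⟨_, h⟩ => ⟨hl, h.trans hadj.symm.reachable⟩⟩) (by
          rcases x with x | x
          · exact Or.inl ⟨x.1, x.2, x.2, SimpleGraph.Reachable.refl _⟩
          · exact Or.inr ⟨x.1, x.2, x.2, SimpleGraph.Reachable.refl _⟩)
      rcases y with y | y
      · exact (key.1 _ y.2).2
      · exact (key.2 _ y.2).2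
    have hne : Nonempty (L ⊕ R) := by
      rcases L.eq_empty_or_nonempty with rfl | ⟨l, hl⟩
      · rcases R.eq_empty_or_nonempty with rfl | ⟨r, hr⟩
        · have := h.card
          simp at this
        · exact ⟨Sum.inr ⟨r, hr⟩⟩
      · exact ⟨Sum.inl ⟨l, hl⟩⟩
    exact ⟨hpre⟩

end Graph

theorem extGraph_eq_bipGraph {A : Type*} (S : Set (List A)) (w : List A) :
    extGraph S w = bipGraph (leftExt S w) (rightExt S w) (fun a b => a :: (w ++ [b]) ∈ S) := by
  ext x y
  rcases x with x | x <;> rcases y with y | y <;> rfl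

theorem isTree_extGraph_iff {A : Type*} {S : Set (List A)} {w : List A}
    (hL : (leftExt S w).Finite) (hR : (rightExt S w).Finite) :
    (extGraph S w).IsTree ↔
      BipTree (leftExt S w) (rightExt S w) (fun a b => a :: (w ++ [b]) ∈ S) := by
  rw [extGraph_eq_bipGraph, isTree_bipGraph_iff hL hR]

end WordSet

/-! ### Generalized extension graphs and the parity code -/

namespace WordSet

variable {A : Type*}

/-- The generalized extension graph of `w` in `S`, with left extensions in `U` and right extensions
in `V`, is a tree. -/
def WTree (S U : Set (List A)) (w : List A) (V : Set (List A)) : Prop :=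
  BipTree {u | u ∈ U ∧ u ++ w ∈ S} {v | v ∈ V ∧ w ++ v ∈ S} (fun u v => u ++ w ++ v ∈ S)

/-- The words of length one whose letter is in `W`. -/
def singletonWords (W : Set A) : Set (List A) := (fun a => [a]) '' W

/-- The words whose last letter satisfies `o`, and no other letter does. -/
def tailCode (o : A → Prop) : Set (List A) :=
  {v | ∃ u a, v = u ++ [a] ∧ (∀ b ∈ u, ¬ o b) ∧ o a}

/-- The words that either are a letter not satisfying `o` or have exactly two letters satisfying
`o`, the first one and the last one. -/
def parityCode (o : A → Prop) : Set (List A) :=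
  {x | (∃ a, ¬ o a ∧ x = [a]) ∨ ∃ a u b, x = a :: (u ++ [b]) ∧ o a ∧ o b ∧ ∀ c ∈ u, ¬ o c}

theorem cons_mem_tailCode_of_not {o : A → Prop} {a : A} (ha : ¬ o a) (t : List A) :
    a :: t ∈ tailCode o ↔ t ∈ tailCode o := by
  constructor
  · rintro ⟨u, b, h, hu, hb⟩
    rcases u with _ | ⟨c, u⟩
    · simp only [List.nil_append, List.cons.injEq] at h
      exact absurd (h.1 ▸ hb) ha
    · simp only [List.cons_append, List.cons.injEq] at h
      exact ⟨u, b, h.2, fun d hd => hu d (List.mem_cons_of_mem _ hd), hb⟩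
  · rintro ⟨u, b, rfl, hu, hb⟩
    exact ⟨a :: u, b, rfl, by simpa using ⟨ha, hu⟩, hb⟩

theorem cons_mem_tailCode {o : A → Prop} {a : A} (ha : o a) (t : List A) :
    a :: t ∈ tailCode o ↔ t = [] := by
  constructor
  · rintro ⟨u, b, h, hu, hb⟩
    rcases u with _ | ⟨c, u⟩
    · simp only [List.nil_append, List.cons.injEq] at h
      exact h.2
    · simp only [List.cons_append, List.cons.injEq] at h
      exact absurd (h.1 ▸ ha) (hu c List.mem_cons_self)
  · rintro rfl
    exact ⟨[], a, rfl, by simp, ha⟩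

theorem cons_mem_parityCode_of_not {o : A → Prop} {a : A} (ha : ¬ o a) (t : List A) :
    a :: t ∈ parityCode o ↔ t = [] := by
  constructor
  · rintro (⟨b, hb, h⟩ | ⟨b, u, c, h, hb, -⟩)
    · exact (List.cons.inj h).2
    · exact absurd ((List.cons.inj h).1 ▸ hb) ha
  · rintro rfl
    exact Or.inl ⟨a, ha, rfl⟩

theorem cons_mem_parityCode {o : A → Prop} {a : A} (ha : o a) (t : List A) :
    a :: t ∈ parityCode o ↔ t ∈ tailCode o := by
  constructor
  · rintro (⟨b, hb, h⟩ | ⟨b, u, c, h, hb, hc, hu⟩)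
    · exact absurd ((List.cons.inj h).1 ▸ ha) hb
    · exact ⟨u, c, (List.cons.inj h).2, hu, hc⟩
  · rintro ⟨u, b, rfl, hu, hb⟩
    exact Or.inr ⟨a, u, b, rfl, ha, hb, hu⟩

theorem nil_notMem_parityCode (o : A → Prop) : [] ∉ parityCode o := by
  rintro (⟨a, _, h⟩ | ⟨a, u, b, h, _⟩) <;> simp at h

theorem reverse_mem_parityCode {o : A → Prop} {x : List A} :
    x.reverse ∈ parityCode o ↔ x ∈ parityCode o := by
  have key : ∀ x : List A, x ∈ parityCode o → x.reverse ∈ parityCode o := by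
    rintro x (⟨a, ha, rfl⟩ | ⟨a, u, b, rfl, ha, hb, hu⟩)
    · exact Or.inl ⟨a, ha, rfl⟩
    · exact Or.inr ⟨b, u.reverse, a, by simp, hb, ha, by simpa using hu⟩
  exact ⟨fun h => by simpa using key _ h, key x⟩

/-- A set of words that contains the factors of its elements. -/
def FactorClosed (S : Set (List A)) : Prop := ∀ w ∈ S, ∀ v : List A, v <:+: w → v ∈ S

/-- The graph only sees those words of `U` and `V` that extend `w` inside `S`. -/
theorem WTree.congr {S U U' V V' : Set (List A)} {w : List A} (h : WTree S U w V)
    (hU : ∀ u, u ++ w ∈ S → (u ∈ U ↔ u ∈ U')) (hV : ∀ v, w ++ v ∈ S → (v ∈ V ↔ v ∈ V')) :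
    WTree S U' w V' := by
  have h1 : {u | u ∈ U ∧ u ++ w ∈ S} = {u | u ∈ U' ∧ u ++ w ∈ S} := by
    ext u; exact and_congr_left (hU u)
  have h2 : {v | v ∈ V ∧ w ++ v ∈ S} = {v | v ∈ V' ∧ w ++ v ∈ S} := by
    ext v; exact and_congr_left (hV v)
  unfold WTree at h ⊢
  rwa [← h1, ← h2]

theorem WTree.reverse {S U V : Set (List A)} {w : List A} (h : WTree S U w V) :
    WTree (List.reverse ⁻¹' S) (List.reverse ⁻¹' V) w.reverse (List.reverse ⁻¹' U) := by
  have h1 : {v | v ∈ List.reverse ⁻¹' V ∧ v ++ w.reverse ∈ List.reverse ⁻¹' S} =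
      List.reverse '' {v | v ∈ V ∧ w ++ v ∈ S} := by
    rw [List.reverse_involutive.image_eq_preimage_symm]
    ext v
    simp
  have h2 : {u | u ∈ List.reverse ⁻¹' U ∧ w.reverse ++ u ∈ List.reverse ⁻¹' S} =
      List.reverse '' {u | u ∈ U ∧ u ++ w ∈ S} := by
    rw [List.reverse_involutive.image_eq_preimage_symm]
    ext v
    simp
  unfold WTree
  rw [h1, h2, BipTree.image_iff List.reverse_injective.injOn List.reverse_injective.injOn
    (E := fun v u => u ++ w ++ v ∈ S) (by simp)]
  exact h.swap

/-- The only right vertex is the empty word, joined to every left vertex: the graph is a star. -/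
theorem wTree_nil {S U : Set (List A)} {w : List A} (hw : w ∈ S)
    (hU : {u | u ∈ U ∧ u ++ w ∈ S}.Finite) : WTree S U w {[]} := by
  have : {v : List A | v ∈ ({[]} : Set (List A)) ∧ w ++ v ∈ S} = {[]} := by
    ext v
    constructor
    · exact fun h => h.1
    · rintro rfl
      exact ⟨rfl, by simpa using hw⟩
  unfold WTree
  rw [this]
  exact BipTree.star hU [] fun u hu => by simpa using hu.2

theorem wTree_singletonWords_iff {S : Set (List A)} {w : List A} {W W' : Set A} :
    WTree S (singletonWords W) w (singletonWords W') ↔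
      BipTree {a | a ∈ W ∧ a :: w ∈ S} {b | b ∈ W' ∧ w ++ [b] ∈ S}
        (fun a b => a :: (w ++ [b]) ∈ S) := by
  have h1 : {u | u ∈ singletonWords W ∧ u ++ w ∈ S} =
      (fun a => [a]) '' {a | a ∈ W ∧ a :: w ∈ S} := by
    ext u
    constructor
    · rintro ⟨⟨a, ha, rfl⟩, h⟩
      exact ⟨a, ⟨ha, h⟩, rfl⟩
    · rintro ⟨a, ⟨ha, h⟩, rfl⟩
      exact ⟨⟨a, ha, rfl⟩, h⟩
  have h2 : {v | v ∈ singletonWords W' ∧ w ++ v ∈ S} =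
      (fun a => [a]) '' {b | b ∈ W' ∧ w ++ [b] ∈ S} := by
    ext u
    constructor
    · rintro ⟨⟨a, ha, rfl⟩, h⟩
      exact ⟨a, ⟨ha, h⟩, rfl⟩
    · rintro ⟨a, ⟨ha, h⟩, rfl⟩
      exact ⟨⟨a, ha, rfl⟩, h⟩
  unfold WTree
  rw [h1, h2]
  exact BipTree.image_iff List.singleton_injective.injOn List.singleton_injective.injOn (by simp)

/-- Expansion of the right extensions by their first letter. -/
theorem WTree.expand {S U V : Set (List A)} {w : List A} {W : Set A} (hS : FactorClosed S)
    (h : WTree S U w (singletonWords W))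
    (hV : ∀ v ∈ V, w ++ v ∈ S → ∃ a ∈ W, ∃ t, v = a :: t)
    (hexp : ∀ a ∈ W, w ++ [a] ∈ S → WTree S U (w ++ [a]) {t | a :: t ∈ V}) :
    WTree S U w V := by
  refine BipTree.subst h (fun v => v.take 1) ?_ ?_ ?_
  · rintro v ⟨hv, hwv⟩
    obtain ⟨a, ha, t, rfl⟩ := hV v hv hwv
    exact ⟨⟨a, ha, rfl⟩, hS _ hwv _ ⟨[], t, by simp⟩⟩
  · rintro _ ⟨⟨a, ha, rfl⟩, hwa⟩
    have key := hexp a ha hwa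
    have h1 : {u | u ∈ {u | u ∈ U ∧ u ++ w ∈ S} ∧ u ++ w ++ [a] ∈ S} =
        id '' {u | u ∈ U ∧ u ++ (w ++ [a]) ∈ S} := by
      ext u
      simp only [Set.mem_ofPred_eq, Set.image_id, List.append_assoc]
      exact ⟨fun h => ⟨h.1.1, h.2⟩, fun h => ⟨⟨h.1, hS _ h.2 _ ⟨[], [a], by simp⟩⟩, h.2⟩⟩
    have h2 : {v | v ∈ {v | v ∈ V ∧ w ++ v ∈ S} ∧ v.take 1 = [a]} =
        (fun t => a :: t) '' {t | t ∈ {t | a :: t ∈ V} ∧ w ++ [a] ++ t ∈ S} := by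
      ext v
      constructor
      · rintro ⟨⟨hv, hwv⟩, hva⟩
        rcases v with _ | ⟨b, t⟩
        · simp at hva
        · simp only [List.take_succ_cons, List.take_zero, List.cons.injEq, and_true] at hva
          subst hva
          exact ⟨t, ⟨hv, by simpa using hwv⟩, rfl⟩
      · rintro ⟨t, ⟨ht, hwt⟩, rfl⟩
        exact ⟨⟨ht, by simpa using hwt⟩, by simp⟩
    rw [h1, h2]
    exact (BipTree.image_iff Function.injective_id.injOn (List.cons_injective).injOn
      (E := fun u v => u ++ (w ++ [a]) ++ v ∈ S) (by simp)).2 key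
  · rintro u hu v ⟨hv, hwv⟩ h
    obtain ⟨a, ha, t, rfl⟩ := hV v hv hwv
    exact hS _ h _ ⟨[], t, by simp⟩

/-- Expand by the first letter `a`. If `a` satisfies `o`, nothing remains to be read and the graph
of `wa` is a star; otherwise the remainder is again in `tailCode o` and the question passes to `wa`.
The bound `M` on runs avoiding `o` ends the recursion. -/
theorem wTree_tailCode {S U : Set (List A)} {o : A → Prop} {M : ℕ} (hS : FactorClosed S)
    (hM : ∀ w ∈ S, (∀ a ∈ w, ¬ o a) → w.length ≤ M)
    (h : ∀ w ∈ S, w ≠ [] → WTree S U w (singletonWords Set.univ)) :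
    ∀ w ∈ S, w ≠ [] → WTree S U w (tailCode o) := by
  have hfin : ∀ w ∈ S, w ≠ [] → {u | u ∈ U ∧ u ++ w ∈ S}.Finite :=
    fun w hw hw0 => (h w hw hw0).finite_left
  -- Here `s` is the run already read and `k` the remaining allowance; at `k = 0` the run would be
  -- longer than `M`, so that case is vacuous.
  have key : ∀ k : ℕ, ∀ w s : List A, w ++ s ∈ S → w ++ s ≠ [] → (∀ a ∈ s, ¬ o a) →
      M < s.length + k → WTree S U (w ++ s) (tailCode o) := by
    intro k
    induction k with
    | zero =>
      intro w s hws _ hs hk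
      have := hM s (hS _ hws _ ⟨w, [], by simp⟩) hs
      omega
    | succ k ih =>
      intro w s hws hne hs hk
      refine (h _ hws hne).expand hS ?_ ?_
      · rintro v ⟨u, a, rfl, -⟩ -
        rcases u with _ | ⟨c, u⟩
        · exact ⟨a, trivial, [], rfl⟩
        · exact ⟨c, trivial, _, rfl⟩
      · intro a _ hwa
        by_cases ha : o a
        · have : {t | a :: t ∈ tailCode o} = {[]} := by
            ext t; exact cons_mem_tailCode ha t
          rw [this]
          exact wTree_nil hwa (hfin _ hwa (by simp))
        · have : {t | a :: t ∈ tailCode o} = tailCode o := by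
            ext t; exact cons_mem_tailCode_of_not ha t
          rw [this, List.append_assoc]
          refine ih w (s ++ [a]) (by simpa using hwa) (by simp) ?_ (by simp; omega)
          simpa [or_imp, forall_and] using ⟨hs, ha⟩
  intro w hw hw0
  simpa using key (M + 1) w [] (by simpa using hw) (by simpa using hw0) (by simp) (by simp)

/-- One expansion reduces the parity code to the tail code after a letter satisfying `o`, and to a
star after any other letter. Restricting first letters to `W` allows the lemma to be used on a
single component of the extension graph of the empty word. -/
theorem wTree_parityCode {S U V : Set (List A)} {o : A → Prop} {W : Set A} {w : List A}
    (hS : FactorClosed S) (h : WTree S U w (singletonWords W))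
    (htail : ∀ a ∈ W, w ++ [a] ∈ S → WTree S U (w ++ [a]) (tailCode o))
    (hV : ∀ a t, w ++ [a] ∈ S → (a :: t ∈ V ↔ a ∈ W ∧ a :: t ∈ parityCode o)) (hnil : [] ∉ V) :
    WTree S U w V := by
  refine h.expand hS ?_ ?_
  · intro v hv hwv
    rcases v with _ | ⟨a, t⟩
    · exact absurd hv hnil
    · exact ⟨a, ((hV a t (hS _ hwv _ ⟨[], t, by simp⟩)).1 hv).1, t, rfl⟩
  · intro a haW hwa
    by_cases ha : o a
    · have : {t | a :: t ∈ V} = tailCode o := by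
        ext t
        simp only [Set.mem_ofPred_eq, hV a t hwa, cons_mem_parityCode ha, haW, true_and]
      rw [this]
      exact htail a haW hwa
    · have : {t | a :: t ∈ V} = {[]} := by
        ext t
        simp only [Set.mem_ofPred_eq, hV a t hwa, cons_mem_parityCode_of_not ha, haW, true_and,
          Set.mem_singleton_iff]
      rw [this]
      exact wTree_nil hwa (htail a haW hwa).finite_left

theorem wTree_right {S U : Set (List A)} {o : A → Prop} {M : ℕ} (hS : FactorClosed S)
    (hM : ∀ w ∈ S, (∀ a ∈ w, ¬ o a) → w.length ≤ M)
    (h : ∀ w ∈ S, w ≠ [] → WTree S U w (singletonWords Set.univ)) :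
    ∀ w ∈ S, w ≠ [] → WTree S U w (parityCode o) := fun w hw hw0 =>
  wTree_parityCode hS (h w hw hw0)
    (fun a _ hwa => wTree_tailCode hS hM h _ hwa (by simp)) (by simp) (nil_notMem_parityCode o)

end WordSet

/-! ### Tree systems and the boundedness of even runs -/

namespace WordSet

variable {A : Type*}

/-- A recurrent set of words all of whose nonempty words have a tree as extension graph, with two
maps `l, r` on the letters such that the extension graph of the empty word is the disjoint union
of the trees with left vertices `l a = i` and right vertices `r b = i`, for `i = 0, 1`. -/
structure TreeSystem (S : Set (List A)) (l r : A → Fin 2) : Prop where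
  factor : FactorClosed S
  letter : ∀ a, [a] ∈ S
  extR : ∀ w ∈ S, ∃ b, w ++ [b] ∈ S
  extL : ∀ w ∈ S, ∃ a, a :: w ∈ S
  tree : ∀ w ∈ S, w ≠ [] →
    BipTree (leftExt S w) (rightExt S w) (fun a b => a :: (w ++ [b]) ∈ S)
  state : ∀ a b, [a, b] ∈ S → l a = r b
  tree_nil : ∀ i, BipTree {a | l a = i} {b | r b = i} (fun a b => [a, b] ∈ S)
  recurrent : ∀ u ∈ S, ∀ w ∈ S, ∃ v, u ++ v ++ w ∈ S

/-- The number of right extensions of a word, minus one. -/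
noncomputable def rightExcess (S : Set (List A)) (w : List A) : ℕ := (rightExt S w).ncard - 1

open Classical in
/-- The sum of the right excesses of the words `u ++ w` with `u` of length `k` without any letter
satisfying `o`. -/
noncomputable def runSum [Fintype A] (S : Set (List A)) (o : A → Prop) : ℕ → List A → ℕ
  | 0, w => rightExcess S w
  | k + 1, w => ∑ a with ¬ o a, runSum S o k (a :: w)

namespace TreeSystem

variable {S : Set (List A)} {l r : A → Fin 2}

/-- The axioms are symmetric up to exchanging `l` and `r`, so each right-hand statement yields its
left-hand version. -/
theorem reverse (h : TreeSystem S l r) : TreeSystem (List.reverse ⁻¹' S) r l where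
  factor w hw v hv := h.factor _ hw _ (List.reverse_infix.2 hv)
  letter a := h.letter a
  extR w hw := by
    obtain ⟨a, ha⟩ := h.extL _ hw
    exact ⟨a, by simpa using ha⟩
  extL w hw := by
    obtain ⟨a, ha⟩ := h.extR _ hw
    exact ⟨a, by simpa using ha⟩
  tree w hw hw0 := by
    have := (h.tree _ hw (by simpa using hw0)).swap
    simpa [leftExt, rightExt] using this
  state a b hab := (h.state b a (by simpa using hab)).symm
  tree_nil i := by simpa using (h.tree_nil i).swap
  recurrent u hu w hw := by
    obtain ⟨v, hv⟩ := h.recurrent _ hw _ hu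
    exact ⟨v.reverse, by simpa using hv⟩

theorem rightExt_eq_empty (h : TreeSystem S l r) {w : List A} (hw : w ∉ S) :
    rightExt S w = ∅ :=
  Set.eq_empty_of_forall_notMem fun b hb => hw (h.factor _ hb _ ⟨[], [b], by simp⟩)

/-- In the tree of `w`, the edges outnumber the left vertices by the number of right vertices minus
one. Counted by left endpoint `a`, the edges number `|R(aw)|` each time. Words outside `S`
contribute zero, thanks to the truncated subtraction. -/
theorem sum_rightExcess_cons [Fintype A] (h : TreeSystem S l r) {w : List A} (hw0 : w ≠ []) :
    ∑ a, rightExcess S (a :: w) = rightExcess S w := by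
  classical
  by_cases hw : w ∈ S
  · have ht := h.tree w hw hw0
    have hsum : ∑ a, rightExcess S (a :: w) =
        ∑ a ∈ ht.finite_left.toFinset, rightExcess S (a :: w) := by
      refine (Finset.sum_subset (Finset.subset_univ _) fun a _ ha => ?_).symm
      have : a :: w ∉ S := fun h' => ha (by simpa [leftExt] using h')
      simp [rightExcess, h.rightExt_eq_empty this]
    have hL : (leftExt S w).ncard = ∑ a ∈ ht.finite_left.toFinset, 1 := by
      rw [Set.ncard_eq_toFinset_card _ ht.finite_left]; simp
    have he := ncard_eq_sum_fiber
      (s := {e : A × A | e.1 ∈ leftExt S w ∧ e.2 ∈ rightExt S w ∧ e.1 :: (w ++ [e.2]) ∈ S})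
      (Set.toFinite _) ht.finite_left Prod.fst (fun e he => he.1)
    have hfib : ∀ a ∈ ht.finite_left.toFinset,
        {e : A × A | e ∈ {e : A × A | e.1 ∈ leftExt S w ∧ e.2 ∈ rightExt S w ∧
          e.1 :: (w ++ [e.2]) ∈ S} ∧ e.1 = a}.ncard = rightExcess S (a :: w) + 1 := by
      intro a ha
      have ha' : a :: w ∈ S := by simpa [leftExt] using ha
      have : {e : A × A | e ∈ {e : A × A | e.1 ∈ leftExt S w ∧ e.2 ∈ rightExt S w ∧
          e.1 :: (w ++ [e.2]) ∈ S} ∧ e.1 = a} = (fun b => (a, b)) '' rightExt S (a :: w) := by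
        ext ⟨c, b⟩
        constructor
        · rintro ⟨⟨_, _, h3⟩, rfl⟩
          exact ⟨b, h3, rfl⟩
        · rintro ⟨b', h3, h4⟩
          obtain ⟨rfl, rfl⟩ := Prod.mk.inj h4
          exact ⟨⟨ha', h.factor _ h3 _ ⟨[a], [], by simp⟩, h3⟩, rfl⟩
      rw [this, Set.ncard_image_of_injective _ (fun _ _ h => (Prod.mk.inj h).2), rightExcess]
      have : 0 < (rightExt S (a :: w)).ncard :=
        (Set.ncard_pos (Set.toFinite _)).2 (h.extR _ ha')
      omega
    rw [Finset.sum_congr rfl hfib, Finset.sum_add_distrib, ← hL, ← hsum] at he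
    have := ht.card
    rw [he] at this
    unfold rightExcess at this ⊢
    omega
  · have hz : ∀ a, a :: w ∉ S := fun a ha => hw (h.factor _ ha _ ⟨[a], [], by simp⟩)
    simp [rightExcess, h.rightExt_eq_empty hw, h.rightExt_eq_empty (hz _)]

theorem runSum_succ_le [Fintype A] (h : TreeSystem S l r) (o : A → Prop) (k : ℕ) :
    ∀ {w : List A}, w ≠ [] → runSum S o (k + 1) w ≤ runSum S o k w := by
  classical
  induction k with
  | zero =>
    intro w hw
    rw [runSum, runSum, ← h.sum_rightExcess_cons hw]
    exact Finset.sum_le_sum_of_subset (Finset.subset_univ _)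
  | succ k ih =>
    intro w hw
    rw [runSum, runSum]
    exact Finset.sum_le_sum fun a _ => ih (by simp)

/-- If a step of `runSum` loses nothing, the discarded terms, those whose new letter satisfies `o`,
all vanish. The run is reversed because `runSum` prepends its letters one at a time. -/
theorem rightExcess_eq_zero [Fintype A] (h : TreeSystem S l r) {o : A → Prop} {a : A} (ha : o a) :
    ∀ (u w : List A), w ≠ [] → (∀ b ∈ u, ¬ o b) →
      runSum S o (u.length + 1) w = runSum S o u.length w →
      rightExcess S (a :: (u.reverse ++ w)) = 0 := by
  classical
  intro u
  induction u with
  | nil =>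
    intro w hw _ heq
    simp only [List.length_nil, runSum] at heq
    rw [← h.sum_rightExcess_cons hw, ← Finset.sum_filter_add_sum_filter_not Finset.univ o] at heq
    have hz : ∑ a with o a, rightExcess S (a :: w) = 0 := by omega
    rw [Finset.sum_eq_zero_iff] at hz
    exact hz a (by simpa using ha)
  -- Each summand is nonincreasing, so equality of the sums forces equality of the summand at `b`.
  | cons b u ih =>
    intro w hw hu heq
    rw [List.length_cons, runSum, runSum] at heq
    have := (Finset.sum_eq_sum_iff_of_le
      (fun c _ => h.runSum_succ_le o u.length (List.cons_ne_nil c w))).1 heq b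
      (by simpa using hu b List.mem_cons_self)
    simpa using ih (b :: w) (by simp) (fun c hc => hu c (List.mem_cons_of_mem _ hc)) this

theorem exists_rightExcess_eq_zero [Finite A] (h : TreeSystem S l r) (o : A → Prop) :
    ∃ N, ∀ a u b, o a → (∀ c ∈ u, ¬ o c) → N ≤ u.length →
      rightExcess S (a :: (u ++ [b])) = 0 := by
  have := Fintype.ofFinite A
  have hN : ∀ b : A, ∃ N, ∀ k, N ≤ k → runSum S o k [b] = runSum S o N [b] := by
    intro b
    have hanti : Antitone fun k => runSum S o k [b] :=
      antitone_nat_of_succ_le fun k => h.runSum_succ_le o k (by simp)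
    obtain ⟨N, hN⟩ := WellFoundedLT.antitone_chain_condition hanti
    exact ⟨N, fun k hk => (hN k hk).symm⟩
  choose N hN using hN
  -- The sum is a common upper bound for the finitely many stabilization ranks.
  refine ⟨∑ b, N b, fun a u b ha hu hlen => ?_⟩
  have hb : N b ≤ u.length := (Finset.single_le_sum (fun _ _ => Nat.zero_le _)
    (Finset.mem_univ b)).trans hlen
  have := h.rightExcess_eq_zero ha u.reverse [b] (by simp) (by simpa using hu) (by
    rw [List.length_reverse, hN b _ hb, hN b _ (hb.trans (Nat.le_succ _))])
  simpa using this

/-- If no letter switched the state, the state would be constant along every word of `S`; but both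
trees are nonempty and recurrence joins a letter of one to a letter of the other. -/
theorem exists_ne (h : TreeSystem S l r) : ∃ a, l a ≠ r a := by
  by_contra! hall
  have key : ∀ v a b, a :: (v ++ [b]) ∈ S → l a = r b := by
    intro v
    induction v with
    | nil => exact fun a b => h.state a b
    | cons c v ih =>
      intro a b hab
      rw [h.state a c (h.factor _ hab _ ⟨[], v ++ [b], by simp⟩), ← hall c]
      exact ih c b (h.factor _ hab _ ⟨[a], [], by simp⟩)
  have hne : ∀ i, ∃ a, l a = i := by
    intro i
    by_contra! hi
    have h1 : {a | l a = i} = ∅ := Set.eq_empty_of_forall_notMem hi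
    have h2 : {a | r a = i} = ∅ := Set.eq_empty_of_forall_notMem fun a => by
      simpa [← hall a] using hi a
    have := (h.tree_nil i).card
    rw [h1, h2] at this
    simp at this
  obtain ⟨a, ha⟩ := hne 0
  obtain ⟨b, hb⟩ := hne 1
  obtain ⟨v, hv⟩ := h.recurrent _ (h.letter a) _ (h.letter b)
  have := key v a b (by simpa using hv)
  rw [← hall b, ha, hb] at this
  simp at this

/-- The lengths of the words of `S` without any letter `a` such that `l a ≠ r a` are bounded. -/
theorem exists_length_le [Finite A] (h : TreeSystem S l r) :
    ∃ M, ∀ w ∈ S, (∀ a ∈ w, ¬ l a ≠ r a) → w.length ≤ M := by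
  set o : A → Prop := fun a => l a ≠ r a with ho
  obtain ⟨N, hN⟩ := h.exists_rightExcess_eq_zero o
  obtain ⟨a₀, ha₀⟩ : ∃ a, o a := h.exists_ne
  -- After a letter satisfying `o` and a run longer than `N`, the right extension is unique. So two
  -- continuations agree as far as both go, provided the longer one, `q`, stays free of such
  -- letters.
  have uniq : ∀ v q a u, o a → (∀ c ∈ u, ¬ o c) → N < u.length → a :: (u ++ v) ∈ S →
      a :: (u ++ q) ∈ S → (∀ c ∈ q, ¬ o c) → v.length ≤ q.length → ∀ c ∈ v, ¬ o c := by
    intro v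
    induction v with
    | nil => simp
    | cons b v ih =>
      intro q a u ha hu hlen hv hq hqo hvq
      rcases q with _ | ⟨c, q⟩
      · simp at hvq
      · have hbc : b = c := by
          obtain ⟨u', d, rfl⟩ := List.eq_nil_or_concat' u |>.resolve_left (by
            rintro rfl; simp at hlen)
          have hz := hN a u' d ha (fun e he => hu e (by simp [he])) (by
            simp at hlen; omega)
          have hone : (rightExt S (a :: (u' ++ [d]))).ncard ≤ 1 := by
            unfold rightExcess at hz; omega
          refine (Set.ncard_le_one (Set.toFinite _)).1 hone _ ?_ _ ?_
          · exact h.factor _ hv _ ⟨[], v, by simp⟩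
          · exact h.factor _ hq _ ⟨[], q, by simp⟩
        subst hbc
        have hb : ¬ o b := hqo b List.mem_cons_self
        have := ih q a (u ++ [b]) ha (by simpa [or_imp, forall_and] using ⟨hu, hb⟩)
          (by simp; omega) (by simpa using hv) (by simpa using hq)
          (fun e he => hqo e (List.mem_cons_of_mem _ he)) (by simpa using hvq)
        simpa [or_imp, forall_and] using ⟨hb, this⟩
  -- Recurrence continues every word of `S` up to an odd letter.
  have hext : ∀ p : List A, ∃ v : List A, p ∈ S → p ++ v ∈ S ∧ ∃ c ∈ v, o c := by
    intro p
    by_cases hp : p ∈ S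
    · obtain ⟨v, hv⟩ := h.recurrent p hp [a₀] (h.letter a₀)
      exact ⟨v ++ [a₀], fun _ => ⟨by simpa using hv, a₀, by simp, ha₀⟩⟩
    · exact ⟨[], fun h => absurd h hp⟩
  choose V hV using hext
  -- There are finitely many words of length `N + 2`, an odd letter and a run of length `N + 1`,
  -- hence a common bound on the chosen continuations.
  obtain ⟨K, hK⟩ : ∃ K, ∀ p : List A, p.length = N + 2 → (V p).length ≤ K := by
    obtain ⟨K, hK⟩ := ((List.finite_length_eq A (N + 2)).image fun p => (V p).length).bddAbove
    exact ⟨K, fun p hp => hK ⟨p, hp, rfl⟩⟩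
  -- A longer run would contain the continuation chosen for its beginning, by uniqueness, and hence
  -- an odd letter.
  have run : ∀ a u, o a → (∀ c ∈ u, ¬ o c) → a :: u ∈ S → u.length ≤ N + 1 + K := by
    intro a u ha hu hau
    by_contra! hlt
    have hp : (a :: u.take (N + 1)).length = N + 2 := by
      simp; omega
    have hpS : a :: u.take (N + 1) ∈ S :=
      h.factor _ hau _ ⟨[], u.drop (N + 1), by simp⟩
    obtain ⟨h1, c, hc, hoc⟩ := hV _ hpS
    refine uniq (V (a :: u.take (N + 1))) (u.drop (N + 1)) a (u.take (N + 1)) ha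
      (fun c hc => hu c (List.mem_of_mem_take hc)) (by simp; omega) h1 (by simpa using hau)
      (fun c hc => hu c (List.mem_of_mem_drop hc)) ?_ c hc hoc
    have := hK _ hp
    simp only [List.length_drop]
    omega
  refine ⟨N + 1 + K, fun w hw hwo => ?_⟩
  obtain ⟨v, hv⟩ := h.recurrent [a₀] (h.letter a₀) w hw
  -- Extend `w` to the left until the last preceding odd letter is met; `a₀` guarantees that there
  -- is one.
  have last : ∀ v w, (∀ c ∈ w, ¬ o c) → a₀ :: (v ++ w) ∈ S → w.length ≤ N + 1 + K := by
    intro v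
    induction v using List.reverseRecOn with
    | nil => exact fun w hwo hw => run a₀ w ha₀ hwo hw
    | append_singleton v b ih =>
      intro w hwo hw
      by_cases hb : o b
      · exact run b w hb hwo (h.factor _ hw _ ⟨a₀ :: v, [], by simp⟩)
      · have := ih (b :: w) (by simpa using ⟨hb, hwo⟩) (by simpa using hw)
        simp only [List.length_cons] at this
        omega
  exact last v w hwo (by simpa using hv)

end TreeSystem

end WordSet

/-! ### Paths in the parity graph -/

namespace WordSet

variable {A B : Type*}

/-- The word `w` labels a path from `i` to `j` in the graph with one edge `r a → l a` labelled by
each letter `a`. -/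
def StatePath (l r : A → Fin 2) : Fin 2 → List A → Fin 2 → Prop
  | i, [], j => i = j
  | i, a :: w, j => r a = i ∧ StatePath l r (l a) w j

section StatePath

variable {l r : A → Fin 2}

theorem statePath_append {u v : List A} : ∀ {i j : Fin 2},
    StatePath l r i (u ++ v) j ↔ ∃ k, StatePath l r i u k ∧ StatePath l r k v j := by
  induction u with
  | nil => simp [StatePath]
  | cons a u ih => simp [StatePath, ih, and_assoc]

theorem StatePath.target_unique {w : List A} : ∀ {i j k : Fin 2}, StatePath l r i w j →
    StatePath l r i w k → j = k := by
  induction w with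
  | nil => exact fun h h' => h.symm.trans h'
  | cons a w ih => exact fun h h' => ih h.2 h'.2

theorem StatePath.source_unique {w : List A} (hw : w ≠ []) {i j k m : Fin 2}
    (h : StatePath l r i w k) (h' : StatePath l r j w m) : i = j := by
  rcases w with _ | ⟨a, w⟩
  · exact absurd rfl hw
  · exact h.1.symm.trans h'.1

theorem statePath_reverse {w : List A} : ∀ {i j : Fin 2},
    StatePath r l j w.reverse i ↔ StatePath l r i w j := by
  induction w with
  | nil => simp [StatePath, eq_comm]
  | cons a w ih =>
    intro i j
    rw [List.reverse_cons, statePath_append]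
    simp only [StatePath, ih]
    constructor
    · rintro ⟨k, h, rfl, h'⟩
      exact ⟨h', h⟩
    · rintro ⟨h, h'⟩
      exact ⟨l a, h', rfl, h⟩

open Classical in
-- There are only two states and exactly the odd letters change the state.
theorem StatePath.even_iff {w : List A} : ∀ {i j : Fin 2}, StatePath l r i w j →
    (Even (w.countP fun a => decide (l a ≠ r a)) ↔ i = j) := by
  induction w with
  | nil => simp [StatePath]
  | cons a w ih =>
    rintro i j ⟨rfl, h⟩
    have := ih h
    by_cases ha : l a = r a
    · rw [List.countP_cons_of_neg (by simpa using ha), this, ha]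
    · rw [List.countP_cons_of_pos (by simpa using ha), Nat.even_add_one, this]
      omega

end StatePath

theorem even_countP_of_mem_parityCode {o : A → Prop} [DecidablePred o] {x : List A} (hx : x ∈ parityCode o) :
    Even (x.countP fun a => decide (o a)) := by
  rcases hx with ⟨a, ha, rfl⟩ | ⟨a, u, b, rfl, ha, hb, hu⟩
  · simp [ha]
  · have : u.countP (fun a => decide (o a)) = 0 := List.countP_eq_zero.2 (by simpa using hu)
    simp [ha, hb, this]

theorem exists_prefix_mem_tailCode {o : A → Prop} {v : List A} (hv : ∃ c ∈ v, o c) :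
    ∃ y ∈ tailCode o, y <+: v := by
  induction v with
  | nil => simp at hv
  | cons a v ih =>
    by_cases ha : o a
    · exact ⟨[a], ⟨[], a, rfl, by simp, ha⟩, ⟨v, rfl⟩⟩
    · obtain ⟨y, hy, hyv⟩ := ih (by simpa [ha] using hv)
      exact ⟨a :: y, (cons_mem_tailCode_of_not ha y).2 hy, (List.prefix_cons_inj a).2 hyv⟩

theorem exists_prefix_mem_parityCode {o : A → Prop} {a : A} {v : List A}
    (hv : o a → ∃ c ∈ v, o c) : ∃ x ∈ parityCode o, x <+: a :: v := by
  by_cases ha : o a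
  · obtain ⟨y, hy, hyv⟩ := exists_prefix_mem_tailCode (hv ha)
    exact ⟨a :: y, (cons_mem_parityCode ha y).2 hy, (List.prefix_cons_inj a).2 hyv⟩
  · exact ⟨[a], Or.inl ⟨a, ha, rfl⟩, ⟨v, rfl⟩⟩

/-! ### Extension graphs with respect to the parity code -/

namespace TreeSystem

variable {S : Set (List A)} {l r : A → Fin 2}

theorem reverse_odd (l r : A → Fin 2) : (fun a => r a ≠ l a) = fun a => l a ≠ r a :=
  funext fun _ => propext ne_comm

theorem finite_parityCode [Finite A] (h : TreeSystem S l r) :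
    (parityCode (fun a => l a ≠ r a) ∩ S).Finite := by
  obtain ⟨M, hM⟩ := h.exists_length_le
  refine (List.finite_length_le A (M + 2)).subset ?_
  rintro x ⟨⟨a, ha, rfl⟩ | ⟨a, u, b, rfl, ha, hb, hu⟩, hx⟩
  · simp
  · have := hM u (h.factor _ hx _ ⟨[a], [b], by simp⟩) hu
    simp only [Set.mem_ofPred_eq, List.length_cons, List.length_append, List.length_nil]
    omega

theorem wTree_singletonWords (h : TreeSystem S l r) {w : List A} (hw : w ∈ S) (hw0 : w ≠ []) :
    WTree S (singletonWords Set.univ) w (singletonWords Set.univ) := by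
  rw [wTree_singletonWords_iff]
  simpa [leftExt, rightExt] using h.tree w hw hw0

theorem wTree_singletonWords_parityCode [Finite A] (h : TreeSystem S l r) {w : List A}
    (hw : w ∈ S) (hw0 : w ≠ []) :
    WTree S (singletonWords Set.univ) w (parityCode (fun a => l a ≠ r a)) := by
  obtain ⟨M, hM⟩ := h.exists_length_le
  exact wTree_right h.factor hM (fun w => h.wTree_singletonWords) w hw hw0

theorem reverse_singletonWords (W : Set A) :
    List.reverse ⁻¹' singletonWords W = singletonWords W := by
  ext w
  constructor
  · rintro ⟨a, ha, h⟩
    exact ⟨a, ha, by simpa using congrArg List.reverse h⟩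
  · rintro ⟨a, ha, rfl⟩
    exact ⟨a, ha, rfl⟩

theorem reverse_parityCode (o : A → Prop) : List.reverse ⁻¹' parityCode o = parityCode o := by
  ext x
  exact reverse_mem_parityCode

theorem reverse_reverse (U : Set (List A)) : List.reverse ⁻¹' (List.reverse ⁻¹' U) = U := by
  ext; simp

/-- The generalized extension graphs of the nonempty words with respect to the parity code
are trees. -/
theorem wTree_parityCode_parityCode [Finite A] (h : TreeSystem S l r) {w : List A}
    (hw : w ∈ S) (hw0 : w ≠ []) :
    WTree S (parityCode (fun a => l a ≠ r a)) w (parityCode (fun a => l a ≠ r a)) := by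
  obtain ⟨M, hM⟩ := h.exists_length_le
  -- The right side has been expanded already; in the reversed system the left side becomes the
  -- right one and is expanded the same way.
  have key := wTree_right (S := List.reverse ⁻¹' S) (U := parityCode (fun a => l a ≠ r a))
    (o := fun a => l a ≠ r a) (M := M) h.reverse.factor
    (fun w hw hwo => by simpa using hM w.reverse hw (by simpa using hwo))
    (fun w hw hw0 => by
      have := (h.wTree_singletonWords_parityCode hw (by simpa using hw0)).reverse
      simpa [reverse_singletonWords, reverse_parityCode] using this)
    w.reverse (by simpa using hw) (by simpa using hw0)
  have := key.reverse
  simpa only [reverse_reverse, reverse_parityCode, List.reverse_reverse] using this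

/-- The words of the parity code with first letter of right state `i`. -/
def rightCode (l r : A → Fin 2) (i : Fin 2) : Set (List A) :=
  {x | x ∈ parityCode (fun a => l a ≠ r a) ∧ ∃ a t, x = a :: t ∧ r a = i}

/-- The words of the parity code with last letter of left state `i`. -/
def leftCode (l r : A → Fin 2) (i : Fin 2) : Set (List A) :=
  {x | x ∈ parityCode (fun a => l a ≠ r a) ∧ ∃ a t, x = t ++ [a] ∧ l a = i}

/-- After a first letter `a` the word is nonempty, and trees are known there for a set `U'` without
state condition. The set `U` carries the condition; the two agree on left extensions of `a`, since
adjacency determines the state. -/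
theorem wTree_nil_right (h : TreeSystem S l r) {U : Set (List A)} {M : ℕ} (i : Fin 2)
    (hM : ∀ w ∈ S, (∀ a ∈ w, ¬ l a ≠ r a) → w.length ≤ M)
    (hU : WTree S U [] (singletonWords {a | r a = i}))
    {U' : Set (List A)} (hU' : ∀ w ∈ S, w ≠ [] → WTree S U' w (singletonWords Set.univ))
    (hUU' : ∀ a, r a = i → ∀ u, u ++ [a] ∈ S → (u ∈ U' ↔ u ∈ U)) :
    WTree S U [] (rightCode l r i) := by
  refine wTree_parityCode (o := fun a => l a ≠ r a) h.factor hU ?_ ?_ ?_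
  · intro a ha haS
    exact (wTree_tailCode h.factor hM hU' _ haS (by simp)).congr (hUU' a ha) (by simp)
  · intro a t _
    simp only [rightCode, Set.mem_ofPred_eq, List.cons.injEq]
    constructor
    · rintro ⟨h1, b, t', ⟨rfl, rfl⟩, h2⟩
      exact ⟨h2, h1⟩
    · rintro ⟨h2, h1⟩
      exact ⟨h1, a, t, ⟨rfl, rfl⟩, h2⟩
  · exact fun hn => nil_notMem_parityCode _ hn.1

theorem wTree_leftCode_rightCode [Finite A] (h : TreeSystem S l r) (i : Fin 2) :
    WTree S (leftCode l r i) [] (rightCode l r i) := by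
  obtain ⟨M, hM⟩ := h.exists_length_le
  -- The starting point is the component numbered `i`; its right side is expanded in `h1` and, after
  -- reversal, its left side in `h2`.
  have h0 : WTree S (singletonWords {a | l a = i}) [] (singletonWords {a | r a = i}) := by
    rw [wTree_singletonWords_iff]
    simpa [h.letter] using h.tree_nil i
  have h1 : WTree S (singletonWords {a | l a = i}) [] (rightCode l r i) := by
    refine h.wTree_nil_right i hM h0 (fun w => h.wTree_singletonWords) ?_
    intro a ha u hu
    constructor
    · rintro ⟨b, _, rfl⟩
      exact ⟨b, (h.state b a hu).trans ha, rfl⟩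
    · rintro ⟨b, _, rfl⟩
      exact ⟨b, trivial, rfl⟩
  have hcode : List.reverse ⁻¹' leftCode l r i = rightCode r l i := by
    ext x
    simp only [leftCode, rightCode, Set.mem_preimage, Set.mem_ofPred_eq, reverse_mem_parityCode,
      reverse_odd l r]
    refine and_congr_right fun _ => ⟨?_, ?_⟩
    · rintro ⟨a, t, h1, h2⟩
      exact ⟨a, t.reverse, by simpa using congrArg List.reverse h1, h2⟩
    · rintro ⟨a, t, rfl, h2⟩
      exact ⟨a, t.reverse, by simp, h2⟩
  have h2 : WTree (List.reverse ⁻¹' S) (List.reverse ⁻¹' rightCode l r i) []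
      (rightCode r l i) := by
    refine h.reverse.wTree_nil_right i (M := M)
      (fun w hw hwo => by simpa using hM w.reverse hw (by simpa [eq_comm] using hwo)) ?_
      (U' := parityCode (fun a => l a ≠ r a)) ?_ ?_
    · simpa [reverse_singletonWords] using h1.reverse
    · intro w hw hw0
      have := (h.wTree_singletonWords_parityCode hw (by simpa using hw0)).reverse
      simpa [reverse_singletonWords, reverse_parityCode] using this
    · intro a ha u hu
      simp only [rightCode, Set.mem_preimage, Set.mem_ofPred_eq, reverse_mem_parityCode]
      refine ⟨fun hu' => ⟨hu', ?_⟩, fun hu' => hu'.1⟩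
      have hu : a :: u.reverse ∈ S := by simpa using hu
      rcases hur : u.reverse with _ | ⟨b, t⟩
      · rw [List.reverse_eq_nil_iff] at hur
        exact absurd (hur ▸ hu') (nil_notMem_parityCode _)
      · rw [hur] at hu
        exact ⟨b, t, rfl, (h.state a b (h.factor _ hu _ ⟨[], t, by simp⟩)).symm.trans ha⟩
  have h3 := h2.reverse
  rw [← hcode] at h3
  simpa only [reverse_reverse, List.reverse_nil] using h3

/-! ### Loops and the decoded sets -/

/-- The words of `S` that label a loop around the state `i`. -/
def loops (S : Set (List A)) (l r : A → Fin 2) (i : Fin 2) : Set (List A) :=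
  {w | w ∈ S ∧ StatePath l r i w i}

theorem exists_statePath (h : TreeSystem S l r) :
    ∀ (w : List A) (a : A), a :: w ∈ S → ∃ j, StatePath l r (r a) (a :: w) j := by
  intro w
  induction w with
  | nil => exact fun a _ => ⟨l a, rfl, rfl⟩
  | cons b w ih =>
    intro a ha
    obtain ⟨j, hj⟩ := ih b (h.factor _ ha _ ⟨[a], [], by simp⟩)
    rw [← h.state a b (h.factor _ ha _ ⟨[], w, by simp⟩)] at hj
    exact ⟨j, rfl, hj⟩

theorem statePath_of_mem_parityCode {x : List A} (hx : x ∈ parityCode (fun a => l a ≠ r a))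
    {i j : Fin 2} (h : StatePath l r i x j) : i = j := by
  classical
  exact h.even_iff.1 (even_countP_of_mem_parityCode hx)

theorem exists_statePath_right (h : TreeSystem S l r) {w x : List A} {i j : Fin 2} (hw0 : w ≠ [])
    (hw : StatePath l r i w j) (hwx : w ++ x ∈ S) : ∃ k, StatePath l r j x k := by
  rcases w with _ | ⟨a, w⟩
  · exact absurd rfl hw0
  · obtain ⟨k, hk⟩ := h.exists_statePath _ _ hwx
    obtain ⟨m, hm, hm'⟩ := statePath_append.1 (show StatePath l r (r a) ((a :: w) ++ x) k from hk)
    rw [hw.1] at hm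
    exact ⟨k, hm.target_unique hw ▸ hm'⟩

/-- The path of `w` ends at `i`, so that of `x` starts there, and evenness of `x` closes it. Next to
a nonempty loop the state condition on code words is thus automatic. -/
theorem mem_loops_right (h : TreeSystem S l r) {w x : List A} {i : Fin 2} (hw0 : w ≠ [])
    (hw : StatePath l r i w i) (hx : x ∈ parityCode (fun a => l a ≠ r a)) (hwx : w ++ x ∈ S) :
    x ∈ loops S l r i := by
  obtain ⟨k, hk⟩ := h.exists_statePath_right hw0 hw hwx
  obtain rfl := statePath_of_mem_parityCode hx hk
  exact ⟨h.factor _ hwx _ ⟨w, [], by simp⟩, hk⟩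

theorem reverse_mem_loops {w : List A} {i : Fin 2} :
    w.reverse ∈ loops (List.reverse ⁻¹' S) r l i ↔ w ∈ loops S l r i := by
  simp [loops, statePath_reverse]

theorem mem_loops_left (h : TreeSystem S l r) {w x : List A} {i : Fin 2} (hw0 : w ≠ [])
    (hw : StatePath l r i w i) (hx : x ∈ parityCode (fun a => l a ≠ r a)) (hxw : x ++ w ∈ S) :
    x ∈ loops S l r i := by
  rw [← reverse_mem_loops]
  refine h.reverse.mem_loops_right (w := w.reverse) (by simpa using hw0) (statePath_reverse.2 hw)
    ?_ (by simpa using hxw)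
  rwa [reverse_odd l r, reverse_mem_parityCode]

theorem append_mem_loops {u v : List A} {i : Fin 2} (hu : StatePath l r i u i)
    (hv : StatePath l r i v i) (huv : u ++ v ∈ S) : u ++ v ∈ loops S l r i :=
  ⟨huv, statePath_append.2 ⟨i, hu, hv⟩⟩

theorem rightCode_inter (h : TreeSystem S l r) {x : List A} {i : Fin 2} (hx : x ∈ S) :
    x ∈ rightCode l r i ↔ x ∈ parityCode (fun a => l a ≠ r a) ∧ x ∈ loops S l r i := by
  constructor
  · rintro ⟨h1, a, t, rfl, rfl⟩
    obtain ⟨j, hj⟩ := h.exists_statePath _ _ hx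
    have := statePath_of_mem_parityCode h1 hj
    exact ⟨h1, hx, by rwa [← this] at hj⟩
  · rintro ⟨h1, -, h2⟩
    rcases x with _ | ⟨a, t⟩
    · exact absurd h1 (nil_notMem_parityCode _)
    · exact ⟨h1, a, t, rfl, h2.1⟩

theorem leftCode_inter (h : TreeSystem S l r) {x : List A} {i : Fin 2} (hx : x ∈ S) :
    x ∈ leftCode l r i ↔ x ∈ parityCode (fun a => l a ≠ r a) ∧ x ∈ loops S l r i := by
  rw [← reverse_mem_loops, ← reverse_mem_parityCode, ← reverse_odd l r,
    ← h.reverse.rightCode_inter (by simpa using hx)]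
  simp only [leftCode, rightCode, Set.mem_ofPred_eq, reverse_mem_parityCode, reverse_odd l r]
  refine and_congr_right fun _ => ⟨?_, ?_⟩
  · rintro ⟨a, t, rfl, h2⟩
    exact ⟨a, t.reverse, by simp, h2⟩
  · rintro ⟨a, t, h1, h2⟩
    exact ⟨a, t.reverse, by simpa using congrArg List.reverse h1, h2⟩

/-- Choose a letter `b` that may follow `w`; recurrence makes an odd letter occur later, so a code
word starting with `b` can be completed inside `S`. For empty `w`, the letter must be chosen with `r
b = i`. -/
theorem exists_append_mem_loops (h : TreeSystem S l r) {w : List A} {i : Fin 2}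
    (hw : w ∈ loops S l r i) :
    ∃ x ∈ parityCode (fun a => l a ≠ r a), x ∈ loops S l r i ∧ w ++ x ∈ loops S l r i := by
  obtain ⟨a₀, ha₀⟩ := h.exists_ne
  have ext : ∀ b, w ++ [b] ∈ S → ∃ x ∈ parityCode (fun a => l a ≠ r a), w ++ x ∈ S ∧
      ∃ t, x = b :: t := by
    intro b hb
    obtain ⟨v, hv⟩ := h.recurrent _ hb _ (h.letter a₀)
    obtain ⟨x, hx, s, hs⟩ := exists_prefix_mem_parityCode (o := fun a => l a ≠ r a) (a := b)
      (v := v ++ [a₀]) (fun _ => ⟨a₀, by simp, ha₀⟩)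
    refine ⟨x, hx, h.factor _ hv _ ⟨[], s, by simp [hs]⟩, ?_⟩
    rcases x with _ | ⟨c, t⟩
    · exact absurd hx (nil_notMem_parityCode _)
    · simp only [List.cons_append, List.cons.injEq] at hs
      exact ⟨t, by rw [hs.1]⟩
  by_cases hw0 : w = []
  · subst hw0
    obtain ⟨b, hb⟩ : ∃ b, r b = i := by
      by_contra! hi
      have h2 : {a | r a = i} = ∅ := Set.eq_empty_of_forall_notMem hi
      by_cases hl : ∃ a, l a = i
      · obtain ⟨a, ha⟩ := hl
        obtain ⟨b, hb⟩ := h.extR [a] (h.letter a)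
        exact hi b ((h.state a b hb).symm.trans ha)
      · have h1 : {a | l a = i} = ∅ := Set.eq_empty_of_forall_notMem fun a ha => hl ⟨a, ha⟩
        have := (h.tree_nil i).card
        rw [h1, h2] at this
        simp at this
    obtain ⟨x, hx, hxS, t, rfl⟩ := ext b (h.letter b)
    have := ((h.rightCode_inter hxS).1 ⟨hx, b, t, rfl, hb⟩).2
    exact ⟨_, hx, this, this⟩
  · obtain ⟨b, hb⟩ := h.extR w hw.1
    obtain ⟨x, hx, hxS, -⟩ := ext b hb
    have := h.mem_loops_right hw0 hw.2 hx hxS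
    exact ⟨x, hx, this, append_mem_loops hw.2 this.2 hxS⟩

theorem exists_append_mem_loops_left (h : TreeSystem S l r) {w : List A} {i : Fin 2}
    (hw : w ∈ loops S l r i) :
    ∃ x ∈ parityCode (fun a => l a ≠ r a), x ∈ loops S l r i ∧ x ++ w ∈ loops S l r i := by
  obtain ⟨x, hx, hxi, hxw⟩ := h.reverse.exists_append_mem_loops (reverse_mem_loops.2 hw)
  rw [reverse_odd l r] at hx
  refine ⟨x.reverse, reverse_mem_parityCode.2 hx, ?_, ?_⟩
  · rw [← reverse_mem_loops]
    simpa using hxi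
  · rw [← reverse_mem_loops]
    simpa using hxw

variable {F : B → List A}

theorem eq_of_statePath_flatMap (hF : ∀ b, F b ∈ parityCode (fun a => l a ≠ r a)) (w : List B) :
    ∀ {i j : Fin 2}, StatePath l r i (w.flatMap F) j → i = j := by
  induction w with
  | nil => exact fun h => h
  | cons b w ih =>
    intro i j hij
    rw [List.flatMap_cons, statePath_append] at hij
    obtain ⟨k, h1, h2⟩ := hij
    exact (statePath_of_mem_parityCode (hF b) h1).trans (ih h2)

theorem flatMap_ne_nil (hF : ∀ b, F b ∈ parityCode (fun a => l a ≠ r a)) {w : List B}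
    (hw : w ≠ []) : w.flatMap F ≠ [] := by
  rcases w with _ | ⟨b, w⟩
  · exact absurd rfl hw
  · intro h
    rw [List.flatMap_cons, List.append_eq_nil_iff] at h
    exact nil_notMem_parityCode _ (h.1 ▸ hF b)

/-- Every word of `S` labelling a loop is a product of words of the parity code. -/
theorem exists_flatMap_eq (h : TreeSystem S l r)
    (hF : Set.BijOn F Set.univ (parityCode (fun a => l a ≠ r a) ∩ S)) (i : Fin 2) :
    ∀ (n : ℕ) (v : List A), v.length ≤ n → v ∈ loops S l r i → ∃ w : List B, w.flatMap F = v := by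
  classical
  intro n
  induction n with
  | zero =>
    intro v hv _
    exact ⟨[], by simpa [eq_comm] using hv⟩
  | succ n ih =>
    intro v hv hvi
    rcases v with _ | ⟨a, t⟩
    · exact ⟨[], rfl⟩
    -- If `a` is odd, a second odd letter must follow, since a loop contains an even number of them.
    · obtain ⟨x, hx, s, hs⟩ := exists_prefix_mem_parityCode (o := fun a => l a ≠ r a) (a := a)
        (v := t) (fun ha => by
          by_contra! hno
          have h1 : t.countP (fun a => decide (l a ≠ r a)) = 0 :=
            List.countP_eq_zero.2 (by simpa using hno)
          have h2 := hvi.2.even_iff.2 rfl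
          rw [List.countP_cons_of_pos (by simpa using ha), h1] at h2
          simp at h2)
      have hxS : x ∈ S := h.factor _ hvi.1 _ ⟨[], s, by simpa using hs⟩
      obtain ⟨b, -, rfl⟩ := hF.surjOn ⟨hx, hxS⟩
      have hpath := hvi.2
      rw [← hs, statePath_append] at hpath
      obtain ⟨k, h1, h2⟩ := hpath
      obtain rfl := statePath_of_mem_parityCode hx h1
      have hlen := congrArg List.length hs
      have hpos : 0 < (F b).length := List.length_pos_iff.2 fun h0 =>
        nil_notMem_parityCode _ (h0 ▸ hx)
      obtain ⟨w, hw⟩ := ih s (by simp at hlen hv; omega)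
        ⟨h.factor _ hvi.1 _ ⟨F b, [], by simpa using hs⟩, h2⟩
      exact ⟨b :: w, by rw [List.flatMap_cons, hw, hs]⟩

/-- The inverse image of the loops around `i` by the coding morphism `F`. -/
def decodeLoops (S : Set (List A)) (l r : A → Fin 2) (F : B → List A) (i : Fin 2) :
    Set (List B) := {w | w.flatMap F ∈ loops S l r i}

theorem nil_mem_loops (h : TreeSystem S l r) (i : Fin 2) : [] ∈ loops S l r i := by
  obtain ⟨a, _⟩ := h.exists_ne
  exact ⟨h.factor _ (h.letter a) _ ⟨[], [a], rfl⟩, rfl⟩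

/-- Each block `F b` inside a loop around `i` returns to `i`, so every factor cut at block
boundaries is again a loop around `i`. -/
theorem isFactorial_decodeLoops (h : TreeSystem S l r)
    (hF : Set.BijOn F Set.univ (parityCode (fun a => l a ≠ r a) ∩ S)) (i : Fin 2) :
    IsFactorial {b | F b ∈ loops S l r i} (decodeLoops S l r F i) := by
  have hFX : ∀ b, F b ∈ parityCode (fun a => l a ≠ r a) := fun b => (hF.mapsTo trivial).1
  have hfac : ∀ w ∈ decodeLoops S l r F i, ∀ v : List B, v <:+: w → v ∈ decodeLoops S l r F i := by
    rintro w hw v ⟨s, t, rfl⟩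
    obtain ⟨hwS, hwp⟩ := hw
    rw [List.flatMap_append, List.flatMap_append] at hwS hwp
    rw [statePath_append] at hwp
    obtain ⟨k, hk, -⟩ := hwp
    rw [statePath_append] at hk
    obtain ⟨m, h1, h2⟩ := hk
    obtain rfl := eq_of_statePath_flatMap hFX _ h1
    obtain rfl := eq_of_statePath_flatMap hFX _ h2
    exact ⟨h.factor _ hwS _ ⟨_, _, rfl⟩, h2⟩
  refine ⟨fun w hw b hb => ?_, fun b hb => by simpa [decodeLoops] using hb, hfac⟩
  have := hfac w hw [b] (List.singleton_infix_iff _ _ |>.2 hb)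
  simpa [decodeLoops] using this

theorem isBiextendable_decodeLoops (h : TreeSystem S l r)
    (hF : Set.BijOn F Set.univ (parityCode (fun a => l a ≠ r a) ∩ S)) (i : Fin 2) :
    IsBiextendable {b | F b ∈ loops S l r i} (decodeLoops S l r F i) where
  toIsFactorial := h.isFactorial_decodeLoops hF i
  extend w hw := by
    obtain ⟨x, hx, hxi, hwx⟩ := h.exists_append_mem_loops hw
    obtain ⟨y, hy, hyi, hywx⟩ := h.exists_append_mem_loops_left hwx
    obtain ⟨b, -, rfl⟩ := hF.surjOn ⟨hx, hxi.1⟩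
    obtain ⟨a, -, rfl⟩ := hF.surjOn ⟨hy, hyi.1⟩
    exact ⟨a, b, by simpa [decodeLoops] using hywx⟩

theorem isRecurrent_decodeLoops (h : TreeSystem S l r)
    (hF : Set.BijOn F Set.univ (parityCode (fun a => l a ≠ r a) ∩ S)) (i : Fin 2) :
    IsRecurrent {b | F b ∈ loops S l r i} (decodeLoops S l r F i) where
  toIsFactorial := h.isFactorial_decodeLoops hF i
  ne_empty_word := by
    intro heq
    obtain ⟨a, b, hab⟩ := (h.isBiextendable_decodeLoops hF i).extend []
      (show ([] : List B).flatMap F ∈ _ from h.nil_mem_loops i)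
    rw [heq] at hab
    simp at hab
  recurrent u hu w hw := by
    have hnil : [] ∈ decodeLoops S l r F i := h.nil_mem_loops i
    by_cases hu0 : u = []
    · exact ⟨[], hnil, by simpa [hu0] using hw⟩
    by_cases hw0 : w = []
    · exact ⟨[], hnil, by simpa [hw0] using hu⟩
    have hFX : ∀ b, F b ∈ parityCode (fun a => l a ≠ r a) := fun b => (hF.mapsTo trivial).1
    -- The connecting word leaves from the state where `u` ends and arrives where `w` starts. Both
    -- images are nonempty, so it is a loop around the same state and can be decoded.
    obtain ⟨v, hv⟩ := h.recurrent _ hu.1 _ hw.1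
    rw [List.append_assoc] at hv
    obtain ⟨k, hk⟩ := h.exists_statePath_right (flatMap_ne_nil hFX hu0) hu.2 hv
    obtain ⟨m, h1, h2⟩ := statePath_append.1 hk
    obtain rfl := h2.source_unique (flatMap_ne_nil hFX hw0) hw.2
    have hvm : v ∈ loops S l r m := ⟨h.factor _ hv _ ⟨_, _, List.append_assoc _ _ _⟩, h1⟩
    obtain ⟨v, rfl⟩ := h.exists_flatMap_eq hF m _ v le_rfl hvm
    refine ⟨v, hvm, ?_⟩
    simp only [decodeLoops, Set.mem_ofPred_eq, List.flatMap_append, List.append_assoc]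
    exact append_mem_loops hu.2 (statePath_append.2 ⟨m, h1, hw.2⟩) hv

/-- The map `F` carries the extension graph of `w` to the generalized extension graph of its image.
For nonempty `w` the full parity code can be used on both sides; for the empty word the state has to
be imposed through `leftCode` and `rightCode`. -/
theorem bipTree_decodeLoops [Finite A] (h : TreeSystem S l r)
    (hF : Set.BijOn F Set.univ (parityCode (fun a => l a ≠ r a) ∩ S)) (i : Fin 2)
    {w : List B} (hw : w ∈ decodeLoops S l r F i) :
    BipTree (leftExt (decodeLoops S l r F i) w) (rightExt (decodeLoops S l r F i) w)
      (fun a b => a :: (w ++ [b]) ∈ decodeLoops S l r F i) := by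
  have hFX : ∀ b, F b ∈ parityCode (fun a => l a ≠ r a) := fun b => (hF.mapsTo trivial).1
  have hinj : ∀ s : Set B, Set.InjOn F s := fun s => hF.injOn.mono (Set.subset_univ s)
  have hE : ∀ a ∈ leftExt (decodeLoops S l r F i) w, ∀ b ∈ rightExt (decodeLoops S l r F i) w,
      (a :: (w ++ [b]) ∈ decodeLoops S l r F i ↔ F a ++ w.flatMap F ++ F b ∈ S) := by
    intro a ha b hb
    have ha' : F a ++ w.flatMap F ∈ loops S l r i := by simpa [leftExt, decodeLoops] using ha
    have hb' : w.flatMap F ++ F b ∈ loops S l r i := by simpa [rightExt, decodeLoops] using hb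
    simp only [decodeLoops, Set.mem_ofPred_eq, List.flatMap_cons, List.flatMap_append,
      List.flatMap_nil, List.append_nil, List.append_assoc]
    refine ⟨fun h => h.1, fun hS => append_mem_loops ?_ hb'.2 hS⟩
    obtain ⟨k, h1, -⟩ := statePath_append.1 ha'.2
    obtain rfl := statePath_of_mem_parityCode (hFX a) h1
    exact h1
  rw [← BipTree.image_iff (hinj _) (hinj _) (E' := fun u v => u ++ w.flatMap F ++ v ∈ S) hE]
  have hw' : w.flatMap F ∈ loops S l r i := hw
  by_cases hw0 : w = []
  · subst hw0
    have key := h.wTree_leftCode_rightCode i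
    unfold WTree at key
    convert key using 1
    · ext x
      constructor
      · rintro ⟨a, ha, rfl⟩
        have ha' : F a ∈ loops S l r i := by simpa [leftExt, decodeLoops] using ha
        exact ⟨(h.leftCode_inter ha'.1).2 ⟨hFX a, ha'⟩, by simpa using ha'.1⟩
      · rintro ⟨hx, hxS⟩
        rw [List.append_nil] at hxS
        obtain ⟨h1, h2⟩ := (h.leftCode_inter hxS).1 hx
        obtain ⟨b, -, rfl⟩ := hF.surjOn ⟨h1, hxS⟩
        exact ⟨b, by simpa [leftExt, decodeLoops] using h2, rfl⟩
    · ext x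
      constructor
      · rintro ⟨a, ha, rfl⟩
        have ha' : F a ∈ loops S l r i := by simpa [rightExt, decodeLoops] using ha
        exact ⟨(h.rightCode_inter ha'.1).2 ⟨hFX a, ha'⟩, by simpa using ha'.1⟩
      · rintro ⟨hx, hxS⟩
        rw [List.nil_append] at hxS
        obtain ⟨h1, h2⟩ := (h.rightCode_inter hxS).1 hx
        obtain ⟨b, -, rfl⟩ := hF.surjOn ⟨h1, hxS⟩
        exact ⟨b, by simpa [rightExt, decodeLoops] using h2, rfl⟩
    · rfl
  · have hne := flatMap_ne_nil hFX hw0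
    have key := h.wTree_parityCode_parityCode hw'.1 hne
    unfold WTree at key
    convert key using 1
    · ext x
      constructor
      · rintro ⟨a, ha, rfl⟩
        have ha' : F a ++ w.flatMap F ∈ loops S l r i := by simpa [leftExt, decodeLoops] using ha
        exact ⟨hFX a, ha'.1⟩
      · rintro ⟨hx, hxS⟩
        have hxi := h.mem_loops_left hne hw'.2 hx hxS
        obtain ⟨b, -, rfl⟩ := hF.surjOn ⟨hx, hxi.1⟩
        exact ⟨b, by simpa [leftExt, decodeLoops] using append_mem_loops hxi.2 hw'.2 hxS, rfl⟩
    · ext x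
      constructor
      · rintro ⟨a, ha, rfl⟩
        have ha' : w.flatMap F ++ F a ∈ loops S l r i := by simpa [rightExt, decodeLoops] using ha
        exact ⟨hFX a, ha'.1⟩
      · rintro ⟨hx, hxS⟩
        have hxi := h.mem_loops_right hne hw'.2 hx hxS
        obtain ⟨b, -, rfl⟩ := hF.surjOn ⟨hx, hxi.1⟩
        exact ⟨b, by simpa [rightExt, decodeLoops] using append_mem_loops hw'.2 hxi.2 hxS, rfl⟩

theorem isTreeSet_decodeLoops [Finite A] (h : TreeSystem S l r)
    (hF : Set.BijOn F Set.univ (parityCode (fun a => l a ≠ r a) ∩ S)) (i : Fin 2) :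
    IsTreeSet {b | F b ∈ loops S l r i} 1 (decodeLoops S l r F i) := by
  have htree : ∀ w ∈ decodeLoops S l r F i, (extGraph (decodeLoops S l r F i) w).IsTree := by
    intro w hw
    have := h.bipTree_decodeLoops hF i hw
    exact (isTree_extGraph_iff this.finite_left this.finite_right).2 this
  have hnil := htree [] (h.nil_mem_loops i)
  have : Subsingleton (extGraph (decodeLoops S l r F i) []).ConnectedComponent :=
    hnil.connected.preconnected.subsingleton_connectedComponent
  have : Nonempty (extGraph (decodeLoops S l r F i) []).ConnectedComponent :=
    hnil.connected.nonempty.map (extGraph (decodeLoops S l r F i) []).connectedComponentMk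
  exact ⟨h.isBiextendable_decodeLoops hF i, fun w hw _ => htree w hw, hnil.isAcyclic,
    inferInstance, Nat.card_unique⟩

end TreeSystem

end WordSet

/-! ### From specular sets to tree systems -/

namespace WordSet

variable {A B : Type*}

/-- A connected component of an acyclic extension graph of the empty word, with left vertices `L`
and right vertices `R`, is a tree. -/
theorem bipTree_connectedComponent [Finite A] {S : Set (List A)} (hS : (extGraph S []).IsAcyclic)
    (C : (extGraph S []).ConnectedComponent) {L R : Set A}
    (hL : ∀ a, a ∈ L ↔ ∃ ha : a ∈ leftExt S [],
      (extGraph S []).connectedComponentMk (Sum.inl ⟨a, ha⟩) = C)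
    (hR : ∀ a, a ∈ R ↔ ∃ ha : a ∈ rightExt S [],
      (extGraph S []).connectedComponentMk (Sum.inr ⟨a, ha⟩) = C) :
    BipTree L R (fun a b => [a, b] ∈ S) := by
  rw [← isTree_bipGraph_iff (Set.toFinite L) (Set.toFinite R)]
  let φ : L ⊕ R → C.supp := Sum.elim
    (fun a => ⟨Sum.inl ⟨a.1, ((hL _).1 a.2).1⟩, ((hL _).1 a.2).2⟩)
    (fun a => ⟨Sum.inr ⟨a.1, ((hR _).1 a.2).1⟩, ((hR _).1 a.2).2⟩)
  have hφ : Function.Bijective φ := by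
    constructor
    · rintro (⟨a, ha⟩ | ⟨a, ha⟩) (⟨b, hb⟩ | ⟨b, hb⟩) h
      · have h' := congrArg Subtype.val h
        simp only [φ, Sum.elim_inl, Sum.inl.injEq, Subtype.mk.injEq] at h'
        subst h'; rfl
      · have h' := congrArg Subtype.val h
        simp [φ] at h'
      · have h' := congrArg Subtype.val h
        simp [φ] at h'
      · have h' := congrArg Subtype.val h
        simp only [φ, Sum.elim_inr, Sum.inr.injEq, Subtype.mk.injEq] at h'
        subst h'; rfl
    · rintro ⟨⟨a, ha⟩ | ⟨a, ha⟩, h⟩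
      · exact ⟨Sum.inl ⟨a, (hL a).2 ⟨ha, h⟩⟩, rfl⟩
      · exact ⟨Sum.inr ⟨a, (hR a).2 ⟨ha, h⟩⟩, rfl⟩
  let e : bipGraph L R (fun a b => [a, b] ∈ S) ≃g C.toSimpleGraph :=
    { toEquiv := Equiv.ofBijective φ hφ
      map_rel_iff' := by
        rintro (a | a) (b | b) <;> exact Iff.rfl }
  exact e.isTree_iff.2 (hS.isTree_connectedComponent C)

/-- A word starting with an even letter has that letter as its shortest nonempty even prefix; one
starting with an odd letter becomes even for the first time at its second odd letter. -/
theorem evenCode_eq {S : Set (List A)} (hS : FactorClosed S) :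
    evenCode S = parityCode (fun a => ¬ IsEvenLetter S a) ∩ S := by
  classical
  ext x
  constructor
  · rintro ⟨⟨hxS, hev⟩, hne, hmin⟩
    rcases x with _ | ⟨a, t⟩
    · exact absurd rfl hne
    · obtain ⟨p, hp, hpx⟩ := exists_prefix_mem_parityCode (o := fun a => ¬ IsEvenLetter S a)
        (a := a) (v := t) (fun ha => by
          by_contra! hno
          have h1 : t.countP (fun a => decide (¬ IsEvenLetter S a)) = 0 :=
            List.countP_eq_zero.2 (by simpa using hno)
          rw [List.countP_cons_of_pos (by simpa using ha), h1] at hev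
          simp at hev)
      by_cases hpe : p = a :: t
      · exact ⟨hpe ▸ hp, hxS⟩
      · exact absurd ⟨hS _ hxS _ hpx.isInfix, even_countP_of_mem_parityCode hp⟩
          (hmin p hpx (fun h0 => nil_notMem_parityCode _ (h0 ▸ hp)) hpe)
  · rintro ⟨hx, hxS⟩
    refine ⟨⟨hxS, even_countP_of_mem_parityCode hx⟩,
      fun h0 => nil_notMem_parityCode _ (h0 ▸ hx), ?_⟩
    rintro p hp hp0 hpx ⟨-, hev⟩
    rcases p with _ | ⟨c, p⟩
    · exact hp0 rfl
    rcases hx with ⟨a, ha, rfl⟩ | ⟨a, u, b, rfl, ha, hb, hu⟩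
    · rw [List.cons_prefix_cons, List.prefix_nil] at hp
      exact hpx (by rw [hp.1, hp.2])
    · rw [List.cons_prefix_cons, List.prefix_concat_iff] at hp
      obtain ⟨rfl, rfl | hp⟩ := hp
      · exact hpx rfl
      · have h1 : p.countP (fun a => decide (¬ IsEvenLetter S a)) = 0 :=
          List.countP_eq_zero.2 fun d hd => by simpa using hu d (hp.subset hd)
        rw [List.countP_cons_of_pos (by simpa using ha), h1] at hev
        simp at hev

section Component

variable {S : Set (List A)} (hS : ∀ a, [a] ∈ S) (T : Fin 2 ≃ (extGraph S []).ConnectedComponent)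

/-- The number of the component of the left vertex `a` in the extension graph of the empty word. -/
def leftState (a : A) : Fin 2 :=
  T.symm ((extGraph S []).connectedComponentMk (Sum.inl ⟨a, hS a⟩))

/-- The number of the component of the right vertex `a` in the extension graph of the empty
word. -/
def rightState (a : A) : Fin 2 :=
  T.symm ((extGraph S []).connectedComponentMk (Sum.inr ⟨a, hS a⟩))

theorem leftState_eq_rightState {a b : A} (h : [a, b] ∈ S) :
    leftState hS T a = rightState hS T b := by
  have hadj : (extGraph S []).Adj (Sum.inl ⟨a, hS a⟩) (Sum.inr ⟨b, hS b⟩) := h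
  unfold leftState rightState
  rw [SimpleGraph.ConnectedComponent.sound hadj.reachable]

theorem treeSystem_of_isTreeSet [Finite A] (ht : IsTreeSet Set.univ 2 S)
    (hrec : IsRecurrent Set.univ S) : TreeSystem S (leftState hS T) (rightState hS T) where
  factor := hrec.factor
  letter := hS
  extR w hw := by
    obtain ⟨a, b, hab⟩ := ht.extend w hw
    exact ⟨b, hrec.factor _ hab _ ⟨[a], [], by simp⟩⟩
  extL w hw := by
    obtain ⟨a, b, hab⟩ := ht.extend w hw
    exact ⟨a, hrec.factor _ hab _ ⟨[], [b], by simp⟩⟩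
  tree w hw hw0 := (isTree_extGraph_iff (Set.toFinite _) (Set.toFinite _)).1 (ht.tree w hw hw0)
  state a b := leftState_eq_rightState hS T
  tree_nil i := by
    refine bipTree_connectedComponent ht.acyclic_empty (T i) ?_ ?_
    · intro a
      exact ⟨fun h => ⟨hS a, T.symm_apply_eq.1 h⟩, fun ⟨_, h⟩ => T.symm_apply_eq.2 h⟩
    · intro a
      exact ⟨fun h => ⟨hS a, T.symm_apply_eq.1 h⟩, fun ⟨_, h⟩ => T.symm_apply_eq.2 h⟩
  recurrent u hu w hw := by
    obtain ⟨v, -, hv⟩ := hrec.recurrent u hu w hw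
    exact ⟨v, hv⟩

theorem isEvenLetter_iff (a : A) : ¬ IsEvenLetter S a ↔ leftState hS T a ≠ rightState hS T a := by
  refine not_congr ?_
  unfold leftState rightState
  rw [T.symm.injective.eq_iff, SimpleGraph.ConnectedComponent.eq]
  exact ⟨fun ⟨_, _, h⟩ => h, fun h => ⟨hS a, hS a, h⟩⟩

/-- An edge lies in the component of either endpoint, so the witnesses `b, c` play no role beyond
their existence, which biextendability ensures. -/
theorem parityEdge_iff (h : TreeSystem S (leftState hS T) (rightState hS T)) {i j : Fin 2}
    {a : A} : ParityEdge S T i a j ↔ rightState hS T a = i ∧ leftState hS T a = j := by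
  constructor
  · rintro ⟨b, c, ⟨_, _, hba, hb⟩, ⟨_, _, _, ha⟩⟩
    exact ⟨(leftState_eq_rightState hS T hba).symm.trans (T.symm_apply_eq.2 hb),
      T.symm_apply_eq.2 ha⟩
  · rintro ⟨hi, hj⟩
    obtain ⟨b, hb⟩ := h.extL [a] (hS a)
    obtain ⟨c, hc⟩ := h.extR [a] (hS a)
    exact ⟨b, c, ⟨hS b, hS a, hb, T.symm_apply_eq.1 ((leftState_eq_rightState hS T hb).trans hi)⟩,
      ⟨hS a, hS c, hc, T.symm_apply_eq.1 hj⟩⟩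

theorem parityPath_iff (h : TreeSystem S (leftState hS T) (rightState hS T)) {w : List A} :
    ∀ {i j : Fin 2}, ParityPath S T i w j ↔
      StatePath (leftState hS T) (rightState hS T) i w j := by
  induction w with
  | nil => exact Iff.rfl
  | cons a w ih => simp [ParityPath, StatePath, parityEdge_iff hS T h, ih, and_assoc]

theorem parityClass_eq_loops (h : TreeSystem S (leftState hS T) (rightState hS T)) (i : Fin 2) :
    parityClass S T i i = TreeSystem.loops S (leftState hS T) (rightState hS T) i := by
  ext w
  exact and_congr_right fun _ => parityPath_iff hS T h

end Component

theorem toList_ofList_eq_flatMap (f : FreeMonoid B →* FreeMonoid A) (w : List B) :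
    (f (FreeMonoid.ofList w)).toList = w.flatMap fun b => (f (FreeMonoid.of b)).toList := by
  induction w with
  | nil => simp
  | cons b w ih =>
    rw [FreeMonoid.ofList_cons, map_mul, FreeMonoid.toList_mul, ih, List.flatMap_cons]

/-- A nonempty word of `S` has a path starting at the right state of its first letter, and a product
of code words returns to its start. The empty word lies in both classes. -/
theorem TreeSystem.flatMap_mem_iff {S : Set (List A)} {l r : A → Fin 2} (h : TreeSystem S l r)
    {F : B → List A} (hF : ∀ b, F b ∈ parityCode (fun a => l a ≠ r a)) (w : List B) :
    w.flatMap F ∈ S ↔ w.flatMap F ∈ loops S l r 0 ∨ w.flatMap F ∈ loops S l r 1 := by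
  constructor
  · intro hw
    rcases hw' : w.flatMap F with _ | ⟨a, t⟩
    · exact Or.inl (h.nil_mem_loops 0)
    · obtain ⟨j, hj⟩ := h.exists_statePath t a (hw' ▸ hw)
      rw [← hw'] at hj ⊢
      have hij := eq_of_statePath_flatMap hF w hj
      rw [← hij] at hj
      generalize r a = i at hj
      fin_cases i
      · exact Or.inl ⟨hw, hj⟩
      · exact Or.inr ⟨hw, hj⟩
  · rintro (hw | hw) <;> exact hw.1

end WordSet

theorem mainTheorem6 {A B : Type*} [Finite A] (θ : A → A) (hθ : Function.Involutive θ)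
    (S : Set (List A)) (hS : WordSet.IsSpecular θ S) (hrec : WordSet.IsRecurrent Set.univ S)
    (f : FreeMonoid B →* FreeMonoid A)
    (hf : WordSet.IsCodingMorphism f (WordSet.evenCode S))
    (T : Fin 2 ≃ (WordSet.extGraph S []).ConnectedComponent) :
    Finite B ∧
    WordSet.decode f S =
      WordSet.decode f (WordSet.parityClass S T 0 0) ∪
        WordSet.decode f (WordSet.parityClass S T 1 1) ∧
    ∀ i : Fin 2,
      WordSet.IsRecurrent
          (WordSet.decodeLetters f (WordSet.evenCode S ∩ WordSet.parityClass S T i i))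
          (WordSet.decode f (WordSet.parityClass S T i i)) ∧
      WordSet.IsTreeSet
          (WordSet.decodeLetters f (WordSet.evenCode S ∩ WordSet.parityClass S T i i)) 1
          (WordSet.decode f (WordSet.parityClass S T i i)) := by
  have hlet : ∀ a, [a] ∈ S := fun a => hrec.alphabet a trivial
  have h := WordSet.treeSystem_of_isTreeSet hlet T hS.treeSet hrec
  have hodd : (fun a => ¬ WordSet.IsEvenLetter S a) =
      fun a => WordSet.leftState hlet T a ≠ WordSet.rightState hlet T a :=
    funext fun a => propext (WordSet.isEvenLetter_iff hlet T a)
  have hF := hf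
  unfold WordSet.IsCodingMorphism at hF
  rw [WordSet.evenCode_eq h.factor, hodd] at hF
  have hdecode : ∀ U : Set (List A), WordSet.decode f U =
      {w | (w.flatMap fun b => (f (FreeMonoid.of b)).toList) ∈ U} := fun U => by
    ext w
    simp only [WordSet.decode, Set.mem_ofPred_eq, WordSet.toList_ofList_eq_flatMap]
  refine ⟨?_, ?_, fun i => ?_⟩
  · have := h.finite_parityCode.to_subtype
    exact Finite.of_injective (fun b => (⟨_, hF.mapsTo (Set.mem_univ b)⟩ :
      ↥(WordSet.parityCode _ ∩ S))) fun a b hab =>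
      hF.injOn (Set.mem_univ a) (Set.mem_univ b) (congrArg Subtype.val hab)
  · simp only [hdecode, WordSet.parityClass_eq_loops hlet T h]
    ext w
    exact h.flatMap_mem_iff (fun b => (hF.mapsTo (Set.mem_univ b)).1) w
  · have hletters : WordSet.decodeLetters f (WordSet.evenCode S ∩ WordSet.parityClass S T i i) =
        {b | (f (FreeMonoid.of b)).toList ∈ WordSet.TreeSystem.loops S
          (WordSet.leftState hlet T) (WordSet.rightState hlet T) i} := by
      rw [WordSet.parityClass_eq_loops hlet T h]
      ext b
      exact ⟨fun hb => hb.2, fun hb => ⟨hf.mapsTo (Set.mem_univ b), hb⟩⟩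
    rw [hletters, WordSet.parityClass_eq_loops hlet T h, hdecode]
    exact ⟨h.isRecurrent_decodeLoops hF i, h.isTreeSet_decodeLoops hF i⟩
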